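/- Let $K$ be a field of characteristic $0$ and consider $K[x_1,\dots,x_n]$ with $x_1<\cdots<x_n$ and the corresponding lexicographic term order. For a nonconstant polynomial $P$ let $\mathrm{lv}(P)$ be the greatest variable appearing in $P$, and let the initial $\mathrm{ini}(P)$ be the leading coefficient of $P$ as a polynomial in $\mathrm{lv}(P)$. A triangular set is a finite nonempty sequence $T=[T_1,\dots,T_r]$ of nonconstant polynomials with $\mathrm{lv}(T_1)<\cdots<\mathrm{lv}(T_r)$; its saturated ideal is $\mathrm{sat}(T)=\{P:\ PJ^k\in\langle T\rangle\text{ for some }k\ge 0\}$ with $J=\mathrm{ini}(T_1)\cdots\mathrm{ini}(T_r)$ (and $\mathrm{sat}(\emptyset)=\langle 0\rangle$). $T$ is *regular* if, for every $i$, $\mathrm{ini}(T_i)$ is neither zero nor a zero divisor in $K[x_1,\dots,x_n]/\mathrm{sat}([T_1,\dots,T_{i-1}])$, and *normal* if no initial $\mathrm{ini}(T_i)$ involves any of the variables $\mathrm{lv}(T_1),\dots,\mathrm{lv}(T_r)$. $T$ satisfies the *variable ordering condition* if every variable which is not among $\mathrm{lv}(T_1),\dots,\mathrm{lv}(T_r)$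 is smaller than all of $\mathrm{lv}(T_1),\dots,\mathrm{lv}(T_r)$. The *W-characteristic set* of an ideal with reduced lexicographic Gröbner basis $G$ consists of the constants in $G$ and, for each $i$ such that $G$ has members with leading variable $x_i$, of the smallest of these members in the lexicographic order. **Theorem.** Let $F\subseteq K[x_1,\dots,x_n]$, and let $\{T_1,\dots,T_e\}$ be a regular triangular decomposition of $F$, that is, the $T_i$ are regular sets and $$\sqrt{\langle F\rangle}=\sqrt{\mathrm{sat}(T_1)}\cap\cdots\cap\sqrt{\mathrm{sat}(T_e)}.$$ Assume that every $T_i$ satisfies the variable ordering condition. Let $G_i$ be the reduced lexicographic Gröbner basis of $\mathrm{sat}(T_i)$ and $C_i$ the W-characteristic set of $\mathrm{sat}(T_i)$. Then $\{(G_1,C_1),\dots,(G_e,C_e)\}$ is a strong normal characteristic decomposition of $F$. That is, for every $i$: $G_i$ is a reduced lexicographic Gröbner basis; $C_i$ is the W-characteristic set of $\langle G_i\rangle$; $\mathrm{sat}(C_i)=\langle G_i\rangle$; and $C_i$ is normal (where the trivial pair $(\{1\},[1])$ also counts as normal). Moreover $$\sqrt{\langle F\rangle}=\sqrt{\mathrm{sat}(C_1)}\cap\cdots\cap\sqrt{\mathrm{sat}(C_e)}=\sqrt{\langle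 G_1\rangle}\cap\cdots\cap\sqrt{\langle G_e\rangle}.$$ -/

import Mathlib

open MvPolynomial

namespace TriangularDecomposition

/-! The polynomial ring `K[x_1, …, x_n]` is `MvPolynomial (Fin n) K`, the variables being ordered
as their indices. -/

section Polynomials

variable {K : Type*} [Field K] {n : ℕ}

/-- The leading variable `lv(F)`: the greatest variable that appears in `F`, and `⊥` if `F` is a
constant. -/
noncomputable def leadVar (F : MvPolynomial (Fin n) K) : WithBot (Fin n) :=
  F.vars.max

/-- The coefficient of `x_i ^ k`, with `k = deg(F, x_i)`, when `F` is seen as a polynomial in `x_i`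
whose coefficients are polynomials in the other variables. -/
noncomputable def leadCoeffIn (i : Fin n) (F : MvPolynomial (Fin n) K) : MvPolynomial (Fin n) K :=
  ∑ d ∈ F.support with d i = F.degreeOf i, monomial (d.erase i) (F.coeff d)

/-- The initial `ini(F)`: the leading coefficient of `F` with respect to its leading variable
(for a constant, which has no leading variable, the value is `F` itself). -/
noncomputable def initial (F : MvPolynomial (Fin n) K) : MvPolynomial (Fin n) K :=
  match leadVar F with
  | ⊥ => F
  | (i : Fin n) => leadCoeffIn i F

/-- A (nontrivial) triangular set: a finite nonempty set of nonconstant polynomials whose leading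
variables are pairwise different. The order of its members in `[T_1, …, T_r]` is the one given by
`lv(T_1) < ⋯ < lv(T_r)`, so it need not be recorded. -/
structure IsTriangularSet (T : Finset (MvPolynomial (Fin n) K)) : Prop where
  nonempty : T.Nonempty
  nonconstant : ∀ P ∈ T, leadVar P ≠ ⊥
  leadVar_injOn : Set.InjOn leadVar (T : Set (MvPolynomial (Fin n) K))

/-- `x_v` is a parameter of `T`: it is not the leading variable of any member of `T`. -/
def IsParameter (T : Finset (MvPolynomial (Fin n) K)) (v : Fin n) : Prop :=
  ∀ P ∈ T, leadVar P ≠ v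

/-- The variable ordering condition: every parameter of `T` is smaller than every leading variable
of a member of `T`. -/
def VariableOrderingCondition (T : Finset (MvPolynomial (Fin n) K)) : Prop :=
  ∀ v, IsParameter T v → ∀ P ∈ T, (v : WithBot (Fin n)) < leadVar P

/-- The saturated ideal `sat(T) = {P | ∃ k, P * J ^ k ∈ ⟨T⟩}`, where `J` is the product of the
initials of the members of `T`. -/
noncomputable def sat (T : Finset (MvPolynomial (Fin n) K)) : Ideal (MvPolynomial (Fin n) K) where
  carrier := {P | ∃ k : ℕ,
    P * (∏ Q ∈ T, initial Q) ^ k ∈ Ideal.span (T : Set (MvPolynomial (Fin n) K))}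
  zero_mem' := ⟨0, by simp⟩
  add_mem' := by
    rintro P Q ⟨k, hk⟩ ⟨l, hl⟩
    refine ⟨k + l, ?_⟩
    have h1 := Ideal.mul_mem_right ((∏ R ∈ T, initial R) ^ l) _ hk
    have h2 := Ideal.mul_mem_right ((∏ R ∈ T, initial R) ^ k) _ hl
    have h3 := Ideal.add_mem _ h1 h2
    convert h3 using 1
    ring
  smul_mem' := by
    rintro c P ⟨k, hk⟩
    refine ⟨k, ?_⟩
    have h := Ideal.mul_mem_left _ c hk
    rwa [← mul_assoc] at h

open Classical in
/-- The members of `T` whose leading variable is smaller than that of `P`; for `P = T_i` in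
`T = [T_1, …, T_r]` this is `[T_1, …, T_{i-1}]`. -/
noncomputable def below (T : Finset (MvPolynomial (Fin n) K)) (P : MvPolynomial (Fin n) K) :
    Finset (MvPolynomial (Fin n) K) :=
  T.filter fun Q => leadVar Q < leadVar P

/-- A regular set (regular chain): a triangular set `[T_1, …, T_r]` such that each `ini(T_i)` is
neither zero nor a zero divisor modulo `sat([T_1, …, T_{i-1}])`. -/
structure IsRegularSet (T : Finset (MvPolynomial (Fin n) K)) : Prop where
  isTriangularSet : IsTriangularSet T
  regular : ∀ P ∈ T,
    Ideal.Quotient.mk (sat (below T P)) (initial P) ≠ 0 ∧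
    Ideal.Quotient.mk (sat (below T P)) (initial P) ∈
      nonZeroDivisors (MvPolynomial (Fin n) K ⧸ sat (below T P))

/-- A normal set: a triangular set whose initials do not involve any of the leading variables of
its members. -/
structure IsNormalSet (T : Finset (MvPolynomial (Fin n) K)) : Prop where
  isTriangularSet : IsTriangularSet T
  normal : ∀ P ∈ T, ∀ v ∈ (initial P).vars, ∀ Q ∈ T, leadVar Q ≠ v

end Polynomials

section Groebner

/-- The lexicographic term order for `x_1 < ⋯ < x_n`: two terms are compared by their exponents of
the greatest variable in which they differ. -/
noncomputable def lexOrder (n : ℕ) : MonomialOrder (Fin n) where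
  syn := Colex (Fin n →₀ ℕ)
  wellFoundedLT_syn := Finsupp.Colex.wellFoundedLT_of_finite
  toSyn := { toEquiv := toColex, map_add' := fun _ _ => rfl }
  toSyn_monotone := Finsupp.toColex_monotone

variable {K : Type*} [Field K] {n : ℕ}

/-- `G` is a lexicographic Gröbner basis of the ideal `I`. -/
structure IsGroebnerBasis (G : Finset (MvPolynomial (Fin n) K))
    (I : Ideal (MvPolynomial (Fin n) K)) : Prop where
  subset : (G : Set (MvPolynomial (Fin n) K)) ⊆ I
  span_leadingTerm :
    Ideal.span ((lexOrder n).leadingTerm '' (G : Set (MvPolynomial (Fin n) K))) =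
      Ideal.span ((lexOrder n).leadingTerm '' (I : Set (MvPolynomial (Fin n) K)))

/-- `G` is a reduced lexicographic Gröbner basis of `I`: all members are monic, and no term of a
member is divisible by the leading term of another member. -/
structure IsReducedGroebnerBasis (G : Finset (MvPolynomial (Fin n) K))
    (I : Ideal (MvPolynomial (Fin n) K)) : Prop where
  isGroebnerBasis : IsGroebnerBasis G I
  monic : ∀ P ∈ G, (lexOrder n).Monic P
  reduced : ∀ P ∈ G, ∀ Q ∈ G, Q ≠ P → ∀ d ∈ P.support, ¬ (lexOrder n).degree Q ≤ d

theorem isGroebnerBasis_iff_of_monic {G : Finset (MvPolynomial (Fin n) K)}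
    {I : Ideal (MvPolynomial (Fin n) K)} (hG : ∀ P ∈ G, (lexOrder n).Monic P) :
    IsGroebnerBasis G I ↔ (G : Set (MvPolynomial (Fin n) K)) ⊆ I ∧
      ∀ F ∈ I, F ≠ 0 → ∃ P ∈ G, (lexOrder n).degree P ≤ (lexOrder n).degree F := by
  have himg : (lexOrder n).leadingTerm '' (G : Set (MvPolynomial (Fin n) K)) =
      (fun s => monomial s (1 : K)) '' ((lexOrder n).degree '' (G : Set (MvPolynomial (Fin n) K))) := by
    rw [Set.image_image]
    refine Set.image_congr fun P hP => ?_
    rw [MonomialOrder.leadingTerm, (hG P hP).leadingCoeff_eq_one]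
  constructor
  · rintro ⟨h1, h2⟩
    refine ⟨h1, fun F hF hF0 => ?_⟩
    have hmem : (lexOrder n).leadingTerm F ∈
        Ideal.span ((lexOrder n).leadingTerm '' (G : Set (MvPolynomial (Fin n) K))) := by
      rw [h2]
      exact Ideal.subset_span ⟨F, hF, rfl⟩
    rw [himg, mem_ideal_span_monomial_image] at hmem
    have hc : (lexOrder n).leadingCoeff F ≠ 0 := MonomialOrder.leadingCoeff_ne_zero_iff.mpr hF0
    obtain ⟨_, ⟨P, hP, rfl⟩, hle⟩ := hmem ((lexOrder n).degree F) (by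
      classical
      simp [MonomialOrder.leadingTerm, mem_support_iff, coeff_monomial, hc])
    exact ⟨P, hP, hle⟩
  · rintro ⟨h1, h2⟩
    refine ⟨h1, le_antisymm (Ideal.span_mono (Set.image_mono h1)) ?_⟩
    rw [Ideal.span_le]
    rintro _ ⟨F, hF, rfl⟩
    rw [SetLike.mem_coe, himg, mem_ideal_span_monomial_image]
    intro d hd
    classical
    rw [MonomialOrder.leadingTerm, mem_support_iff, coeff_monomial] at hd
    by_cases hdF : (lexOrder n).degree F = d
    · rw [if_pos hdF] at hd
      obtain ⟨P, hP, hle⟩ := h2 F hF (MonomialOrder.leadingCoeff_ne_zero_iff.mp hd)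
      exact ⟨_, ⟨P, hP, rfl⟩, hdF ▸ hle⟩
    · exact absurd (if_neg hdF) hd

/-- The leading term of a nonzero `F` in `I` is also that of a monic member of `I` none of whose other
terms is divisible by a leading term of a nonzero member of `I`. -/
theorem exists_reduced_of_mem (I : Ideal (MvPolynomial (Fin n) K))
    (F : MvPolynomial (Fin n) K) (hF : F ∈ I) (hF0 : F ≠ 0) :
    ∃ P ∈ I, (lexOrder n).Monic P ∧ (lexOrder n).degree P = (lexOrder n).degree F ∧
      ∀ d ∈ P.support, d ≠ (lexOrder n).degree P →
        ∀ Q ∈ I, Q ≠ 0 → ¬ (lexOrder n).degree Q ≤ d := by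
  classical
  set m := lexOrder n with hm
  obtain ⟨g, r, h1, h2, h3⟩ := m.div_set (B := {Q | Q ∈ I ∧ Q ≠ 0})
    (fun b hb => (MonomialOrder.leadingCoeff_ne_zero_iff.mpr hb.2).isUnit)
    (monomial (m.degree F) (1 : K))
  have hmemI : monomial (m.degree F) (1 : K) - r ∈ I := by
    rw [h1, add_sub_cancel_right, Finsupp.linearCombination_apply]
    exact Ideal.sum_mem _ fun b _ => I.mul_mem_left _ b.2.1
  have hlt : ∀ d ∈ r.support, m.toSyn d < m.toSyn (m.degree F) := by
    intro d hd
    have hle : m.toSyn (m.degree r) ≤ m.toSyn (m.degree F) := by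
      have hr : r = monomial (m.degree F) (1 : K) -
          Finsupp.linearCombination _ (fun b : {Q | Q ∈ I ∧ Q ≠ 0} =>
            (b : MvPolynomial (Fin n) K)) g := by
        rw [h1]; ring
      have hmon : m.toSyn (m.degree (monomial (m.degree F) (1 : K))) ≤ m.toSyn (m.degree F) :=
        m.degree_monomial_le _
      rw [hr]
      refine le_trans MonomialOrder.degree_sub_le (sup_le hmon ?_)
      rw [Finsupp.linearCombination_apply, Finsupp.sum]
      refine le_trans MonomialOrder.degree_sum_le (Finset.sup_le fun b _ => ?_)
      rw [smul_eq_mul, mul_comm]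
      exact (h2 b).trans hmon
    refine lt_of_le_of_ne ((m.le_degree hd).trans hle) fun he => ?_
    have he' : d = m.degree F := m.toSyn.injective he
    exact h3 d hd F ⟨hF, hF0⟩ he'.ge
  have hnotin : m.degree F ∉ r.support := fun h => lt_irrefl _ (hlt _ h)
  have hcoeff : (monomial (m.degree F) (1 : K) - r).coeff (m.degree F) = 1 := by
    rw [coeff_sub, coeff_monomial, if_pos rfl, notMem_support_iff.mp hnotin, sub_zero]
  have hsupp : ∀ d ∈ (monomial (m.degree F) (1 : K) - r).support,
      d ≠ m.degree F → d ∈ r.support := by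
    intro d hd hne
    rw [mem_support_iff, coeff_sub, coeff_monomial, if_neg (Ne.symm hne), zero_sub] at hd
    rw [mem_support_iff]
    exact fun h => hd (by rw [h, neg_zero])
  have hdeg : m.degree (monomial (m.degree F) (1 : K) - r) = m.degree F := by
    apply m.toSyn.injective
    apply le_antisymm
    · rw [MonomialOrder.degree_le_iff]
      intro d hd
      by_cases hne : d = m.degree F
      · rw [hne]
      · exact (hlt d (hsupp d hd hne)).le
    · apply m.le_degree
      rw [mem_support_iff, hcoeff]
      exact one_ne_zero
  refine ⟨_, hmemI, ?_, hdeg, ?_⟩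
  · rw [MonomialOrder.Monic, MonomialOrder.leadingCoeff, hdeg, hcoeff]
  · intro d hd hne Q hQ hQ0
    rw [hdeg] at hne
    exact h3 d (hsupp d hd hne) Q ⟨hQ, hQ0⟩

/-- Every ideal has exactly one reduced lexicographic Gröbner basis. -/
theorem existsUnique_isReducedGroebnerBasis (I : Ideal (MvPolynomial (Fin n) K)) :
    ∃! G : Finset (MvPolynomial (Fin n) K), IsReducedGroebnerBasis G I := by
  classical
  set m := lexOrder n with hm
  let S : Set (Fin n →₀ ℕ) := {d | ∃ F ∈ I, F ≠ 0 ∧ m.degree F = d}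
  have hfin : {d | Minimal (· ∈ S) d}.Finite :=
    (setOfPred_minimal_antichain (· ∈ S)).finite_of_partiallyWellOrderedOn
      (Set.isPWO_of_wellQuasiOrderedLE _)
  have hex : ∀ d : Fin n →₀ ℕ, ∃ P : MvPolynomial (Fin n) K, d ∈ S →
      P ∈ I ∧ m.Monic P ∧ m.degree P = d ∧
        ∀ c ∈ P.support, c ≠ d → ∀ Q ∈ I, Q ≠ 0 → ¬ m.degree Q ≤ c := by
    intro d
    by_cases hd : d ∈ S
    · obtain ⟨F, hF, hF0, rfl⟩ := hd
      obtain ⟨P, h1, h2, h3, h4⟩ := exists_reduced_of_mem I F hF hF0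
      exact ⟨P, fun _ => ⟨h1, h2, h3, h3 ▸ h4⟩⟩
    · exact ⟨0, fun h => absurd h hd⟩
  choose p hp using hex
  have hmin : ∀ d ∈ S, ∃ e, Minimal (· ∈ S) e ∧ e ≤ d := by
    intro d hd
    obtain ⟨e, hle, he⟩ := exists_minimal_le_of_wellFoundedLT (· ∈ S) d hd
    exact ⟨e, he, hle⟩
  have hex2 : IsReducedGroebnerBasis (hfin.toFinset.image p) I := by
    have hG : ∀ P ∈ hfin.toFinset.image p, ∃ d, Minimal (· ∈ S) d ∧ p d = P := by
      intro P hP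
      simpa using hP
    have hmonic : ∀ P ∈ hfin.toFinset.image p, m.Monic P := by
      intro P hP
      obtain ⟨d, hd, rfl⟩ := hG P hP
      exact (hp d hd.prop).2.1
    refine ⟨(isGroebnerBasis_iff_of_monic hmonic).mpr ⟨?_, ?_⟩, hmonic, ?_⟩
    · intro P hP
      obtain ⟨d, hd, rfl⟩ := hG P hP
      exact (hp d hd.prop).1
    · intro F hF hF0
      obtain ⟨e, he, hle⟩ := hmin (m.degree F) ⟨F, hF, hF0, rfl⟩
      refine ⟨p e, ?_, ?_⟩
      · rw [Finset.mem_image]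
        exact ⟨e, hfin.mem_toFinset.mpr he, rfl⟩
      · exact (hp e he.prop).2.2.1.le.trans hle
    · intro P hP Q hQ hne c hc hle
      obtain ⟨d, hd, rfl⟩ := hG P hP
      obtain ⟨e, he, rfl⟩ := hG Q hQ
      by_cases hcd : c = d
      · rw [hcd] at hle
        change m.degree (p e) ≤ d at hle
        rw [(hp e he.prop).2.2.1] at hle
        have : d = e := le_antisymm (hd.le_of_le he.prop hle) hle
        exact hne (by rw [this])
      · exact (hp d hd.prop).2.2.2 c hc hcd (p e) (hp e he.prop).1
          (hp e he.prop).2.1.ne_zero hle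
  have key : ∀ G H : Finset (MvPolynomial (Fin n) K), IsReducedGroebnerBasis G I →
      IsReducedGroebnerBasis H I → G ⊆ H := by
    intro G H hG hH P hP
    obtain ⟨hGI, hGd⟩ := (isGroebnerBasis_iff_of_monic hG.monic).mp hG.isGroebnerBasis
    obtain ⟨hHI, hHd⟩ := (isGroebnerBasis_iff_of_monic hH.monic).mp hH.isGroebnerBasis
    obtain ⟨Q, hQ, hQP⟩ := hHd P (hGI hP) (hG.monic P hP).ne_zero
    obtain ⟨R, hR, hRQ⟩ := hGd Q (hHI hQ) (hH.monic Q hQ).ne_zero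
    have hRP : R = P := by
      by_contra hne
      exact hG.reduced P hP R hR hne _ (m.degree_mem_support (hG.monic P hP).ne_zero)
        (hRQ.trans hQP)
    have hdeg : m.degree Q = m.degree P := le_antisymm hQP (hRP ▸ hRQ)
    have haux : ∀ (G' : Finset (MvPolynomial (Fin n) K)), IsReducedGroebnerBasis G' I →
        ∀ P' ∈ G', ∀ d ∈ P'.support, d ≠ m.degree P' → ∀ R ∈ I, R ≠ 0 → m.degree R ≠ d := by
      intro G' hG' P' hP' d hd hne R hR hR0 hRd
      obtain ⟨-, hGd'⟩ := (isGroebnerBasis_iff_of_monic hG'.monic).mp hG'.isGroebnerBasis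
      obtain ⟨N, hN, hNR⟩ := hGd' R hR hR0
      have hNd : m.degree N ≤ d := hRd ▸ hNR
      by_cases hNP : N = P'
      · rw [hNP] at hNd
        exact hne (m.toSyn.injective (le_antisymm (m.le_degree hd) (m.toSyn_monotone hNd)))
      · exact hG'.reduced P' hP' N hN hNP d hd hNd
    have hPQ : P = Q := by
      by_contra hne
      have hsub : P - Q ≠ 0 := sub_ne_zero.mpr hne
      have hsubI : P - Q ∈ I := I.sub_mem (hGI hP) (hHI hQ)
      have hmem := m.degree_mem_support hsub
      have hc : (P - Q).coeff (m.degree P) = 0 := by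
        rw [coeff_sub, (hG.monic P hP).coeff_degree, ← hdeg, (hH.monic Q hQ).coeff_degree,
          sub_self]
      have hdne : m.degree (P - Q) ≠ m.degree P := by
        intro h
        rw [h, mem_support_iff] at hmem
        exact hmem hc
      rcases Finset.mem_union.mp (support_sub (Fin n) P Q hmem) with h | h
      · exact haux G hG P hP _ h hdne _ hsubI hsub rfl
      · exact haux H hH Q hQ _ h (hdeg ▸ hdne) _ hsubI hsub rfl
    rw [hPQ]
    exact hQ
  refine ⟨hfin.toFinset.image p, hex2, fun H hH => ?_⟩
  exact Finset.Subset.antisymm (key _ _ hH hex2) (key _ _ hex2 hH)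

/-- The reduced lexicographic Gröbner basis of `I`. -/
noncomputable def groebnerBasis (I : Ideal (MvPolynomial (Fin n) K)) :
    Finset (MvPolynomial (Fin n) K) :=
  (existsUnique_isReducedGroebnerBasis I).choose

open Classical in
/-- The W-characteristic set of `I`: it consists of the constants in the reduced lexicographic
Gröbner basis `G` of `I` and, for each variable `x_i`, of the smallest polynomial, if there is any,
among the members of `G` with leading variable `x_i`. (The leading terms of the members of `G` are
different, so polynomials in `G` are compared by their leading terms.) -/
noncomputable def wCharSet (I : Ideal (MvPolynomial (Fin n) K)) :
    Finset (MvPolynomial (Fin n) K) :=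
  (groebnerBasis I).filter fun P => leadVar P = ⊥ ∨
    ∀ Q ∈ groebnerBasis I, leadVar Q = leadVar P →
      (lexOrder n).toSyn ((lexOrder n).degree P) ≤ (lexOrder n).toSyn ((lexOrder n).degree Q)

/-- `(G, C)` is a characteristic pair: `G` is a reduced lexicographic Gröbner basis, and `C` is the
W-characteristic set of the ideal generated by `G`. -/
structure IsCharPair (G C : Finset (MvPolynomial (Fin n) K)) : Prop where
  isReducedGroebnerBasis :
    IsReducedGroebnerBasis G (Ideal.span (G : Set (MvPolynomial (Fin n) K)))
  eq_wCharSet : C = wCharSet (Ideal.span (G : Set (MvPolynomial (Fin n) K)))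

/-- A characteristic pair `(G, C)` is strong if `sat(C) = ⟨G⟩`. -/
structure IsStrongCharPair (G C : Finset (MvPolynomial (Fin n) K)) : Prop where
  isCharPair : IsCharPair G C
  sat_eq : sat C = Ideal.span (G : Set (MvPolynomial (Fin n) K))

/-- A characteristic pair `(G, C)` is normal if `C` is normal; the trivial pair `({1}, [1])` is
regarded as normal as well. -/
structure IsNormalCharPair (G C : Finset (MvPolynomial (Fin n) K)) : Prop where
  isCharPair : IsCharPair G C
  normal : IsNormalSet C ∨ (G = {1} ∧ C = {1})

/-- `T_1, …, T_e` is a regular triangular decomposition of the polynomial set `F`: the `T_i` are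
regular sets, and `√⟨F⟩ = √sat(T_1) ∩ ⋯ ∩ √sat(T_e)`. -/
structure IsRegularTriangularDecomposition (F : Set (MvPolynomial (Fin n) K)) {e : ℕ}
    (T : Fin e → Finset (MvPolynomial (Fin n) K)) : Prop where
  regular : ∀ i, IsRegularSet (T i)
  radical_eq : (Ideal.span F).radical = ⨅ i, (sat (T i)).radical

/-- `(G_1, C_1), …, (G_e, C_e)` is a strong normal characteristic decomposition of the polynomial
set `F`: each `(G_i, C_i)` is a strong and normal characteristic pair, and
`√⟨F⟩ = √sat(C_1) ∩ ⋯ ∩ √sat(C_e) = √⟨G_1⟩ ∩ ⋯ ∩ √⟨G_e⟩`. -/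
structure IsStrongNormalCharDecomposition (F : Set (MvPolynomial (Fin n) K)) {e : ℕ}
    (GC : Fin e → Finset (MvPolynomial (Fin n) K) × Finset (MvPolynomial (Fin n) K)) :
    Prop where
  strong : ∀ i, IsStrongCharPair (GC i).1 (GC i).2
  normal : ∀ i, IsNormalCharPair (GC i).1 (GC i).2
  radical_eq_sat : (Ideal.span F).radical = ⨅ i, (sat (GC i).2).radical
  radical_eq_span : (Ideal.span F).radical =
    ⨅ i, (Ideal.span ((GC i).1 : Set (MvPolynomial (Fin n) K))).radical

end Groebner

end TriangularDecomposition

/-! Fix a regular set T satisfying the variable ordering condition, and let I = sat(T), with reduced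
Gröbner basis G and W-characteristic set C. Everything follows once sat(C) = I and C is normal,
since the decomposition of √⟨F⟩ then transfers verbatim.

The structure of I is controlled one variable at a time. If a polynomial of sat(T_1, …, T_r) has
smaller degree in lv(T_r) than T_r, then it already lies in sat(T_1, …, T_{r-1})
(`mem_sat_of_mem_sat_insert`). Consequently nonzero polynomials in the parameters are regular modulo
I, none of them lies in I, and no member of G with leading variable x_i = lv(P), P ∈ T, has smaller
x_i-degree than P.

The opposite bound needs elements of I with normal initials. Modulo the earlier part of the chain,
every smaller variable is algebraic over the parameters, so the regular element ini(P) divides a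
nonzero parameter polynomial q. Multiplying P by the cofactor and correcting the top coefficient
yields N ∈ I with the degree of P and initial q (`exists_isNormalMember`). A member g of G whose
leading term divides that of N has leading term x_i^d times parameters. The element of C with
leading variable x_i is lexicographically no larger than g. As the parameters are the smallest
variables, this forces its degree to be d and its initial to involve parameters only
(`wCharSet_member`).

Thus C has the leading variables and degrees of T, and its initials are regular modulo I.
Pseudo-division by C in place of T then gives sat(C) = I (`sat_wCharSet`). -/

namespace TriangularDecomposition

/-! ### Polynomials in one chosen variable, pseudo-division and regularity modulo an ideal -/

section Univariate

variable {K : Type*} [Field K] {n : ℕ}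

/-- `F` seen as a polynomial in `x_i` whose coefficients do not involve `x_i`. -/
noncomputable def toUnivariate (i : Fin n) :
    MvPolynomial (Fin n) K →ₐ[K] Polynomial (MvPolynomial (Fin n) K) :=
  aeval (Function.update (fun j => Polynomial.C (X j)) i Polynomial.X)

theorem toUnivariate_X_self (i : Fin n) :
    toUnivariate i (X i : MvPolynomial (Fin n) K) = Polynomial.X := by
  simp [toUnivariate]

theorem toUnivariate_of_notMem_vars {i : Fin n} {F : MvPolynomial (Fin n) K} (h : i ∉ F.vars) :
    toUnivariate i F = Polynomial.C F := by
  refine hom_congr_vars (f₁ := (toUnivariate i : MvPolynomial (Fin n) K →ₐ[K] _).toRingHom)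
    (f₂ := Polynomial.C) ?_ ?_ rfl
  · ext a : 1
    exact (toUnivariate i).commutes a
  · intro j hj _
    have hne : j ≠ i := fun hji => h (hji ▸ hj)
    simp [toUnivariate, hne]

theorem toUnivariate_monomial (i : Fin n) (d : Fin n →₀ ℕ) (c : K) :
    toUnivariate i (monomial d c) =
      Polynomial.C (monomial (d.erase i) c) * Polynomial.X ^ d i := by
  classical
  have h : monomial d c = monomial (d.erase i) c * X i ^ d i := by
    rw [X_pow_eq_monomial, monomial_mul, mul_one, Finsupp.erase_add_single]
  have hv : i ∉ (monomial (d.erase i) c : MvPolynomial (Fin n) K).vars := by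
    intro hi
    obtain ⟨e, he, hie⟩ := (mem_vars_iff_mem_support i).mp hi
    have := support_monomial_subset he
    rw [Finset.mem_singleton] at this
    subst this
    simp at hie
  rw [h, map_mul, map_pow, toUnivariate_X_self, toUnivariate_of_notMem_vars hv]

theorem coeff_toUnivariate (i : Fin n) (F : MvPolynomial (Fin n) K) (k : ℕ) :
    (toUnivariate i F).coeff k =
      ∑ d ∈ F.support with d i = k, monomial (d.erase i) (F.coeff d) := by
  conv_lhs => rw [F.as_sum, map_sum]
  rw [Polynomial.finsetSum_coeff, Finset.sum_filter]
  refine Finset.sum_congr rfl fun d _ => ?_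
  rw [toUnivariate_monomial, Polynomial.coeff_C_mul_X_pow]
  simp only [eq_comm]

theorem coeff_coeff_toUnivariate (i : Fin n) (F : MvPolynomial (Fin n) K) (k : ℕ)
    (e : Fin n →₀ ℕ) :
    ((toUnivariate i F).coeff k).coeff e =
      if e i = 0 then F.coeff (e + Finsupp.single i k) else 0 := by
  classical
  induction F using MvPolynomial.induction_on' with
  | monomial d c =>
    have key : (e i = 0 ∧ d = e + Finsupp.single i k) ↔ (k = d i ∧ d.erase i = e) := by
      constructor
      · rintro ⟨h0, rfl⟩
        refine ⟨by simp [h0], ?_⟩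
        ext j
        by_cases hj : j = i
        · subst hj; simp [h0]
        · simp [hj]
      · rintro ⟨rfl, rfl⟩
        exact ⟨by simp, (Finsupp.erase_add_single i d).symm⟩
    rw [toUnivariate_monomial, Polynomial.coeff_C_mul_X_pow, coeff_monomial, ← ite_and,
      if_congr key rfl rfl, ite_and]
    split_ifs with h1 h2
    · rw [coeff_monomial, if_pos h2]
    · rw [coeff_monomial, if_neg h2]
    · rfl
  | add p q hp hq =>
    rw [map_add, Polynomial.coeff_add, coeff_add, hp, hq]
    split_ifs <;> simp

theorem support_coeff_toUnivariate {i : Fin n} {F : MvPolynomial (Fin n) K} {k : ℕ}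
    {e : Fin n →₀ ℕ} (he : e ∈ ((toUnivariate i F).coeff k).support) :
    e i = 0 ∧ e + Finsupp.single i k ∈ F.support := by
  rw [mem_support_iff, coeff_coeff_toUnivariate] at he
  split_ifs at he with h
  · exact ⟨h, mem_support_iff.mpr he⟩
  · exact absurd rfl he

theorem erase_mem_support_coeff_toUnivariate (i : Fin n) {F : MvPolynomial (Fin n) K}
    {d : Fin n →₀ ℕ} (hd : d ∈ F.support) :
    d.erase i ∈ ((toUnivariate i F).coeff (d i)).support := by
  rw [mem_support_iff, coeff_coeff_toUnivariate, if_pos (by simp), Finsupp.erase_add_single]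
  exact mem_support_iff.mp hd

theorem natDegree_toUnivariate (i : Fin n) (F : MvPolynomial (Fin n) K) :
    (toUnivariate i F).natDegree = F.degreeOf i := by
  apply le_antisymm
  · rw [Polynomial.natDegree_le_iff_coeff_eq_zero]
    intro k hk
    by_contra hne
    obtain ⟨e, he⟩ := support_nonempty.mpr hne
    obtain ⟨h0, h1⟩ := support_coeff_toUnivariate he
    have := monomial_le_degreeOf i h1
    simp [h0] at this
    omega
  · rw [degreeOf_le_iff]
    intro d hd
    apply Polynomial.le_natDegree_of_ne_zero
    exact support_nonempty.mp ⟨_, erase_mem_support_coeff_toUnivariate i hd⟩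

theorem leadCoeffIn_eq_leadingCoeff (i : Fin n) (F : MvPolynomial (Fin n) K) :
    leadCoeffIn i F = (toUnivariate i F).leadingCoeff := by
  rw [Polynomial.leadingCoeff, coeff_toUnivariate, natDegree_toUnivariate, leadCoeffIn]

theorem vars_coeff_toUnivariate {i j : Fin n} {F : MvPolynomial (Fin n) K} {k : ℕ}
    (hj : j ∈ ((toUnivariate i F).coeff k).vars) : j ≠ i ∧ j ∈ F.vars := by
  obtain ⟨e, he, hje⟩ := (mem_vars_iff_mem_support j).mp hj
  obtain ⟨h0, h1⟩ := support_coeff_toUnivariate he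
  rw [Finsupp.mem_support_iff] at hje
  refine ⟨fun h => hje (h ▸ h0), (mem_vars_iff_mem_support j).mpr ⟨_, h1, ?_⟩⟩
  rw [Finsupp.mem_support_iff, Finsupp.add_apply]
  omega

theorem eval_toUnivariate (i : Fin n) (F : MvPolynomial (Fin n) K) :
    (toUnivariate i F).eval (X i) = F := by
  classical
  have h : ((Polynomial.evalRingHom (X i)).comp
      (toUnivariate i : MvPolynomial (Fin n) K →ₐ[K] _).toRingHom) = RingHom.id _ := by
    refine MvPolynomial.ringHom_ext (fun a => ?_) fun j => ?_
    · have := (toUnivariate i : MvPolynomial (Fin n) K →ₐ[K] _).commutes a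
      change Polynomial.eval (X i) (toUnivariate i (algebraMap _ _ a)) = _
      rw [this]
      exact Polynomial.eval_C
    · change Polynomial.eval (X i) (toUnivariate i (X j)) = X j
      by_cases hj : j = i
      · subst hj
        simp [toUnivariate]
      · simp [toUnivariate, hj]
  exact DFunLike.congr_fun h F

theorem toUnivariate_injective (i : Fin n) :
    Function.Injective (toUnivariate i : MvPolynomial (Fin n) K → _) :=
  Function.LeftInverse.injective (g := Polynomial.eval (X i)) (eval_toUnivariate i)

theorem leadCoeffIn_ne_zero {i : Fin n} {F : MvPolynomial (Fin n) K} (hF : F ≠ 0) :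
    leadCoeffIn i F ≠ 0 := by
  rw [leadCoeffIn_eq_leadingCoeff, Ne, Polynomial.leadingCoeff_eq_zero]
  exact fun h => hF (toUnivariate_injective i (by rw [h, map_zero]))

theorem vars_leadCoeffIn {i j : Fin n} {F : MvPolynomial (Fin n) K}
    (hj : j ∈ (leadCoeffIn i F).vars) : j ≠ i ∧ j ∈ F.vars := by
  rw [leadCoeffIn_eq_leadingCoeff] at hj
  exact vars_coeff_toUnivariate hj

theorem degreeOf_pos_iff_mem_vars {i : Fin n} {F : MvPolynomial (Fin n) K} :
    0 < F.degreeOf i ↔ i ∈ F.vars := by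
  rw [Nat.pos_iff_ne_zero, mem_vars_iff_degreeOf_ne_zero]

/-- `I` contains, with `F`, the coefficients of `F` as a polynomial in `x_i`. -/
def CoeffStable (i : Fin n) (I : Ideal (MvPolynomial (Fin n) K)) : Prop :=
  ∀ F ∈ I, ∀ k, (toUnivariate i F).coeff k ∈ I

/-- For such I, membership can be tested coefficientwise over the quotient, where degrees and
leading coefficients in x_i are available. -/
theorem CoeffStable.map_eq_zero_iff {i : Fin n} {I : Ideal (MvPolynomial (Fin n) K)}
    (hI : CoeffStable i I) {F : MvPolynomial (Fin n) K} :
    (toUnivariate i F).map (Ideal.Quotient.mk I) = 0 ↔ F ∈ I := by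
  constructor
  · intro h
    rw [← eval_toUnivariate i F, Polynomial.eval_eq_sum_range]
    refine I.sum_mem fun k _ => I.mul_mem_right _ ?_
    rw [← Ideal.Quotient.eq_zero_iff_mem, ← Polynomial.coeff_map, h, Polynomial.coeff_zero]
  · intro h
    ext k
    rw [Polynomial.coeff_map, Polynomial.coeff_zero, Ideal.Quotient.eq_zero_iff_mem]
    exact hI F h k

/-- Pseudo-division by `T` with respect to `x_i`. -/
theorem exists_pseudoDivision {i : Fin n} {T : MvPolynomial (Fin n) K} (hT : i ∈ T.vars)
    (F : MvPolynomial (Fin n) K) :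
    ∃ (l : ℕ) (b r : MvPolynomial (Fin n) K),
      leadCoeffIn i T ^ l * F = b * T + r ∧ r.degreeOf i < T.degreeOf i := by
  rw [← degreeOf_pos_iff_mem_vars] at hT
  induction hD : F.degreeOf i using Nat.strong_induction_on generalizing F with
  | _ D ih =>
    by_cases hlt : D < T.degreeOf i
    · exact ⟨0, 0, F, by simp, hD ▸ hlt⟩
    rw [not_lt] at hlt
    set h := leadCoeffIn i T with hh
    set c := leadCoeffIn i F with hc
    have hhv : i ∉ h.vars := fun hi => (vars_leadCoeffIn hi).1 rfl
    have hcv : i ∉ c.vars := fun hi => (vars_leadCoeffIn hi).1 rfl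
    set e := D - T.degreeOf i with he
    -- One elimination step: h and c are free of x_i, and the two terms of degree D cancel.
    have hdeg : (h * F - c * X i ^ e * T).degreeOf i < D := by
      rw [← natDegree_toUnivariate]
      have key : ∀ k, D ≤ k → (toUnivariate i (h * F - c * X i ^ e * T)).coeff k = 0 := by
        intro k hk
        rw [map_sub, map_mul, map_mul, map_mul, map_pow, toUnivariate_X_self,
          toUnivariate_of_notMem_vars hhv, toUnivariate_of_notMem_vars hcv, mul_assoc,
          Polynomial.coeff_sub, Polynomial.coeff_C_mul, Polynomial.coeff_C_mul,
          Polynomial.coeff_X_pow_mul', if_pos (by omega)]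
        rcases eq_or_lt_of_le hk with rfl | hk
        · rw [show D - e = T.degreeOf i by omega, ← natDegree_toUnivariate i T]
          conv_lhs => rw [← hD, ← natDegree_toUnivariate i F]
          rw [hc, hh, leadCoeffIn_eq_leadingCoeff, leadCoeffIn_eq_leadingCoeff]
          simp only [Polynomial.leadingCoeff]
          ring
        · rw [Polynomial.coeff_eq_zero_of_natDegree_lt (p := toUnivariate i F),
            Polynomial.coeff_eq_zero_of_natDegree_lt (p := toUnivariate i T)]
          · ring
          · rw [natDegree_toUnivariate]; omega
          · rw [natDegree_toUnivariate]; omega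
      -- If the degree were still at least D, `key` would kill the leading coefficient. The
      -- polynomial would be 0, of degree 0, whereas D ≥ deg T > 0.
      by_contra hcon
      rw [not_lt] at hcon
      have h0 := key _ hcon
      rw [Polynomial.coeff_natDegree, Polynomial.leadingCoeff_eq_zero] at h0
      rw [h0, Polynomial.natDegree_zero] at hcon
      omega
    obtain ⟨l, b, r, h1, h2⟩ := ih _ hdeg _ rfl
    refine ⟨l + 1, b + h ^ l * c * X i ^ e, r, ?_, h2⟩
    linear_combination h1

/-- `c` is not a zero divisor modulo `I`. -/
def RegularMod (I : Ideal (MvPolynomial (Fin n) K)) (c : MvPolynomial (Fin n) K) : Prop :=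
  ∀ a, c * a ∈ I → a ∈ I

theorem RegularMod.mul {I : Ideal (MvPolynomial (Fin n) K)} {c d : MvPolynomial (Fin n) K}
    (hc : RegularMod I c) (hd : RegularMod I d) : RegularMod I (c * d) :=
  fun a ha => hd a (hc _ (by rwa [← mul_assoc]))

theorem RegularMod.pow {I : Ideal (MvPolynomial (Fin n) K)} {c : MvPolynomial (Fin n) K}
    (hc : RegularMod I c) (k : ℕ) : RegularMod I (c ^ k) := by
  induction k with
  | zero => exact fun a ha => by simpa using ha
  | succ k ih => rw [pow_succ]; exact ih.mul hc

/-- Degree argument modulo I: if c F ≡ a T, then the regular leading coefficient of T makes the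
right side of degree at least deg T unless a vanishes modulo I, while c F has smaller degree. -/
theorem mem_of_mul_mem_sup_span {i : Fin n} {I : Ideal (MvPolynomial (Fin n) K)}
    (hI : CoeffStable i I) {T : MvPolynomial (Fin n) K} (hT : RegularMod I (leadCoeffIn i T))
    {c : MvPolynomial (Fin n) K} (hc : RegularMod I c) (hci : i ∉ c.vars)
    {F : MvPolynomial (Fin n) K} (hdeg : F.degreeOf i < T.degreeOf i)
    (h : c * F ∈ I ⊔ Ideal.span {T}) : F ∈ I := by
  obtain ⟨s, hs, t, ht, hst⟩ := Submodule.mem_sup.mp h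
  obtain ⟨a, rfl⟩ := Ideal.mem_span_singleton'.mp ht
  suffices ha : a ∈ I from hc F (hst ▸ I.add_mem hs (I.mul_mem_right _ ha))
  rw [← hI.map_eq_zero_iff]
  by_contra ha
  set π := Ideal.Quotient.mk I with hπ
  have h1 := congrArg (fun p => (toUnivariate i p).map π) hst
  simp only [map_add, map_mul, Polynomial.map_add, Polynomial.map_mul,
    toUnivariate_of_notMem_vars hci, Polynomial.map_C] at h1
  rw [hI.map_eq_zero_iff.mpr hs, zero_add] at h1
  set A := (toUnivariate i a).map π with hA
  -- The top coefficient of a T modulo I. It lies beyond the degree of c F, hence vanishes, and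
  -- regularity then gives A = 0.
  have h2 : (A * (toUnivariate i T).map π).coeff (A.natDegree + T.degreeOf i) =
      A.leadingCoeff * π (leadCoeffIn i T) := by
    rw [Polynomial.coeff_mul_add_eq_of_natDegree_le le_rfl
      (Polynomial.natDegree_map_le.trans (natDegree_toUnivariate i T).le),
      leadCoeffIn_eq_leadingCoeff, ← natDegree_toUnivariate i T, Polynomial.coeff_natDegree]
    exact congrArg _ (Polynomial.coeff_map π _)
  rw [h1, Polynomial.coeff_C_mul, Polynomial.coeff_eq_zero_of_natDegree_lt, mul_zero] at h2
  · have h3 : A.leadingCoeff = 0 := by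
      obtain ⟨x, hx⟩ := Ideal.Quotient.mk_surjective A.leadingCoeff
      rw [← hx, ← hπ, ← map_mul, eq_comm, hπ, Ideal.Quotient.eq_zero_iff_mem] at h2
      rw [← hx, Ideal.Quotient.eq_zero_iff_mem]
      exact hT _ (by rwa [mul_comm])
    exact ha (Polynomial.leadingCoeff_eq_zero.mp h3)
  · refine lt_of_le_of_lt Polynomial.natDegree_map_le ?_
    rw [natDegree_toUnivariate]
    omega

/-- The factor c is traded for a power of the leading coefficient of T: the pseudo-remainder of F
has small degree, so the preceding lemma cancels c from it. -/
theorem exists_pow_mul_mem_sup_span {i : Fin n} {I : Ideal (MvPolynomial (Fin n) K)}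
    (hI : CoeffStable i I) {T : MvPolynomial (Fin n) K} (hTi : i ∈ T.vars)
    (hT : RegularMod I (leadCoeffIn i T)) {c : MvPolynomial (Fin n) K} (hc : RegularMod I c)
    (hci : i ∉ c.vars) {F : MvPolynomial (Fin n) K} (h : c * F ∈ I ⊔ Ideal.span {T}) :
    ∃ l, leadCoeffIn i T ^ l * F ∈ I ⊔ Ideal.span {T} := by
  obtain ⟨l, b, r, h1, h2⟩ := exists_pseudoDivision hTi F
  have hbT : b * T ∈ I ⊔ Ideal.span {T} :=
    Ideal.mem_sup_right (Ideal.mul_mem_left _ _ (Ideal.mem_span_singleton_self T))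
  refine ⟨l, h1 ▸ Ideal.add_mem _ hbT (Ideal.mem_sup_left ?_)⟩
  refine mem_of_mul_mem_sup_span hI hT hc hci h2 ?_
  have h3 : c * r = leadCoeffIn i T ^ l * (c * F) - c * (b * T) := by linear_combination -c * h1
  rw [h3]
  exact Ideal.sub_mem _ (Ideal.mul_mem_left _ _ h) (Ideal.mul_mem_left _ _ hbT)

end Univariate

/-! ### Algebraicity of roots over rings that need not be domains -/

section Algebraic

/-- A root of a polynomial with algebraic coefficients whose top coefficient lies in the (image of
the) base domain is algebraic. -/
theorem isAlgebraic_of_eval_eq_zero {R B : Type*} [CommRing R] [IsDomain R] [CommRing B]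
    [Algebra R B] {p : Polynomial B} {x : B} (hp : p.eval x = 0)
    (hcoeff : ∀ k, IsAlgebraic R (p.coeff k)) {q : R} (hq : q ≠ 0)
    (hlead : p.coeff p.natDegree = algebraMap R B q) : IsAlgebraic R x := by
  classical
  -- A common multiple s of the denominators makes every coefficient integral, so s p comes from a
  -- polynomial P over the integral closure.
  choose r hr0 hr using fun k => (hcoeff k).exists_integral_multiple
  set s := ∏ k ∈ Finset.range (p.natDegree + 1), r k with hs
  have hs0 : s ≠ 0 := Finset.prod_ne_zero_iff.mpr fun k _ => hr0 k
  have hint : ∀ k, IsIntegral R (s • p.coeff k) := by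
    intro k
    by_cases hk : k ∈ Finset.range (p.natDegree + 1)
    · rw [hs, ← Finset.prod_erase_mul _ _ hk, mul_smul]
      exact (hr k).smul _
    · rw [Polynomial.coeff_eq_zero_of_natDegree_lt (by simpa using hk), smul_zero]
      exact isIntegral_zero
  set P : Polynomial (integralClosure R B) :=
    ∑ k ∈ Finset.range (p.natDegree + 1), Polynomial.monomial k ⟨s • p.coeff k, hint k⟩ with hP
  have hPc : ∀ k, ((P.coeff k : integralClosure R B) : B) = s • p.coeff k := by
    intro k
    rw [hP, Polynomial.finsetSum_coeff]
    simp only [Polynomial.coeff_monomial]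
    rw [Finset.sum_ite_eq']
    split_ifs with h
    · rfl
    · rw [Polynomial.coeff_eq_zero_of_natDegree_lt (by simpa using h), smul_zero]
      rfl
  have hmap : P.map (algebraMap (integralClosure R B) B) = s • p := by
    ext k
    rw [Polynomial.coeff_map, Polynomial.coeff_smul]
    exact hPc k
  have hroot : P.eval₂ (algebraMap (integralClosure R B) B) x = 0 := by
    rw [← Polynomial.eval_map, hmap, Polynomial.eval_smul, hp, smul_zero]
  have hmul : IsIntegral R ((s * q) • x) := by
    have hc : ((P.coeff p.natDegree : integralClosure R B) : B) = algebraMap R B (s * q) := by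
      rw [hPc, hlead, Algebra.smul_def, map_mul]
    -- The map from R to B need not be injective, so s q may become 0 in B. Then (s q) x = 0 is
    -- integral for trivial reasons. Otherwise the leading coefficient of P times x is integral.
    by_cases h0 : P.coeff p.natDegree = 0
    · rw [Algebra.smul_def, ← hc, h0]
      simpa using isIntegral_zero
    · have hdeg : P.natDegree = p.natDegree := by
        refine le_antisymm ?_ (Polynomial.le_natDegree_of_ne_zero h0)
        rw [Polynomial.natDegree_le_iff_coeff_eq_zero]
        intro k hk
        apply Subtype.ext
        rw [hPc, Polynomial.coeff_eq_zero_of_natDegree_lt hk, smul_zero]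
        rfl
      have h1 := isIntegral_leadingCoeff_smul P x hroot
      rw [Polynomial.leadingCoeff, hdeg, Algebra.smul_def] at h1
      rw [Algebra.smul_def, ← hc]
      exact isIntegral_trans (R := R) (A := integralClosure R B) _ h1
  exact IsAlgebraic.of_smul (mem_nonZeroDivisors_of_ne_zero (mul_ne_zero hs0 hq))
    hmul.isAlgebraic

end Algebraic

/-! ### Saturated ideals along a regular chain -/

section Chains

variable {K : Type*} [Field K] {n : ℕ}

theorem leadVar_eq_coe_iff {P : MvPolynomial (Fin n) K} {i : Fin n} :
    leadVar P = i ↔ i ∈ P.vars ∧ ∀ j ∈ P.vars, j ≤ i := by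
  constructor
  · exact fun h => ⟨Finset.mem_of_max h, fun j hj => Finset.le_max_of_eq hj h⟩
  · rintro ⟨h1, h2⟩
    refine le_antisymm (Finset.max_le fun j hj => WithBot.coe_le_coe.mpr (h2 j hj))
      (Finset.le_max h1)

theorem exists_leadVar_eq {P : MvPolynomial (Fin n) K} (hP : leadVar P ≠ ⊥) :
    ∃ i : Fin n, leadVar P = i :=
  (WithBot.ne_bot_iff_exists.mp hP).imp fun _ h => h.symm

theorem initial_eq_leadCoeffIn {P : MvPolynomial (Fin n) K} {i : Fin n} (h : leadVar P = i) :
    initial P = leadCoeffIn i P := by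
  unfold initial
  rw [h]

theorem vars_initial_subset (P : MvPolynomial (Fin n) K) : (initial P).vars ⊆ P.vars := by
  by_cases h : leadVar P = ⊥
  · unfold initial
    rw [h]
  · obtain ⟨i, hi⟩ := exists_leadVar_eq h
    rw [initial_eq_leadCoeffIn hi]
    exact fun j hj => (vars_leadCoeffIn hj).2

theorem span_le_sat (S : Finset (MvPolynomial (Fin n) K)) :
    Ideal.span (S : Set (MvPolynomial (Fin n) K)) ≤ sat S :=
  fun F hF => ⟨0, by simpa using hF⟩

theorem sat_empty : sat (∅ : Finset (MvPolynomial (Fin n) K)) = ⊥ := by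
  rw [eq_bot_iff]
  rintro F ⟨k, hk⟩
  simpa using hk

theorem sat_mono {S S' : Finset (MvPolynomial (Fin n) K)} (h : S ⊆ S') : sat S ≤ sat S' := by
  rintro F ⟨k, hk⟩
  refine ⟨k, ?_⟩
  obtain ⟨c, hc⟩ := Finset.prod_dvd_prod_of_subset S S' initial h
  rw [hc, mul_pow, ← mul_assoc]
  exact Ideal.mul_mem_right _ _ (Ideal.span_mono (by exact_mod_cast h) hk)

theorem regularMod_sat_prod (S : Finset (MvPolynomial (Fin n) K)) :
    RegularMod (sat S) (∏ Q ∈ S, initial Q) := by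
  rintro F ⟨k, hk⟩
  refine ⟨k + 1, ?_⟩
  convert hk using 1
  ring

theorem regularMod_sat_initial {S : Finset (MvPolynomial (Fin n) K)}
    {Q : MvPolynomial (Fin n) K} (hQ : Q ∈ S) : RegularMod (sat S) (initial Q) := by
  intro F hF
  obtain ⟨c, hc⟩ := Finset.dvd_prod_of_mem initial hQ
  apply regularMod_sat_prod S
  rw [hc, mul_comm _ c, mul_assoc]
  exact Ideal.mul_mem_left _ _ hF

theorem notMem_vars_prod_initial {S : Finset (MvPolynomial (Fin n) K)} {i : Fin n}
    (hS : ∀ Q ∈ S, i ∉ Q.vars) : i ∉ (∏ Q ∈ S, initial Q).vars := by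
  classical
  intro hi
  obtain ⟨Q, hQ, hiQ⟩ := Finset.mem_biUnion.mp (vars_prod _ hi)
  exact hS Q hQ (vars_initial_subset Q hiQ)

theorem notMem_vars_mul {c d : MvPolynomial (Fin n) K} {i : Fin n} (hc : i ∉ c.vars)
    (hd : i ∉ d.vars) : i ∉ (c * d).vars :=
  fun h => (Finset.mem_union.mp (vars_mul c d h)).elim hc hd

theorem notMem_vars_pow {c : MvPolynomial (Fin n) K} {i : Fin n} (hc : i ∉ c.vars) (k : ℕ) :
    i ∉ (c ^ k).vars :=
  fun h => hc (vars_pow c k h)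

/-- The generators and the product of their initials are free of x_i, and taking coefficients in x_i
is linear over such polynomials. -/
theorem coeffStable_sat {S : Finset (MvPolynomial (Fin n) K)} {i : Fin n}
    (hS : ∀ Q ∈ S, i ∉ Q.vars) : CoeffStable i (sat S) := by
  have hspan : CoeffStable i (Ideal.span (S : Set (MvPolynomial (Fin n) K))) := by
    intro F hF
    induction hF using Submodule.span_induction with
    | mem Q hQ =>
      intro k
      rw [toUnivariate_of_notMem_vars (hS Q hQ), Polynomial.coeff_C]
      split_ifs
      · exact Ideal.subset_span hQ
      · exact Ideal.zero_mem _
    | zero => simp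
    | add F G _ _ hF hG =>
      intro k
      rw [map_add, Polynomial.coeff_add]
      exact Ideal.add_mem _ (hF k) (hG k)
    | smul a F _ hF =>
      intro k
      rw [smul_eq_mul, map_mul, Polynomial.coeff_mul]
      exact Ideal.sum_mem _ fun x _ => Ideal.mul_mem_left _ _ (hF _)
  rintro F ⟨l, hl⟩ k
  refine ⟨l, ?_⟩
  have h := hspan _ hl k
  rwa [map_mul, toUnivariate_of_notMem_vars (notMem_vars_pow (notMem_vars_prod_initial hS) l),
    Polynomial.coeff_mul_C] at h

section Insert

variable {S : Finset (MvPolynomial (Fin n) K)} {T : MvPolynomial (Fin n) K} {i : Fin n}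

open Classical in
-- After passing from ⟨S⟩ to sat(S), only the new initial has to be inverted: the initials of S are
-- regular modulo sat(S) and free of x_i, so `exists_pow_mul_mem_sup_span` removes them.
theorem mem_sat_insert_iff (hS : ∀ Q ∈ S, i ∉ Q.vars) (hTi : leadVar T = i)
    (hT : RegularMod (sat S) (initial T)) {F : MvPolynomial (Fin n) K} :
    F ∈ sat (insert T S) ↔ ∃ l, initial T ^ l * F ∈ sat S ⊔ Ideal.span {T} := by
  have hTv := (leadVar_eq_coe_iff.mp hTi).1
  have hTS : T ∉ S := fun h => hS T h hTv
  have hini := initial_eq_leadCoeffIn hTi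
  have hiv : i ∉ (initial T).vars := by
    rw [hini]
    exact fun h => (vars_leadCoeffIn h).1 rfl
  constructor
  · rintro ⟨k, hk⟩
    rw [Finset.prod_insert hTS, Finset.coe_insert, Ideal.span_insert, sup_comm, mul_comm] at hk
    have hreg := (hT.mul (regularMod_sat_prod S)).pow k
    have hfree := notMem_vars_pow (notMem_vars_mul hiv (notMem_vars_prod_initial hS)) k
    rw [hini] at hT ⊢
    exact exists_pow_mul_mem_sup_span (coeffStable_sat hS) hTv hT hreg hfree
      (sup_le_sup_right (span_le_sat S) _ hk)
  · rintro ⟨l, hl⟩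
    have hle : sat S ⊔ Ideal.span {T} ≤ sat (insert T S) := by
      refine sup_le (sat_mono (Finset.subset_insert _ _)) ?_
      rw [Ideal.span_singleton_le_iff_mem]
      exact span_le_sat _ (Ideal.subset_span (by simp))
    exact (regularMod_sat_initial (Finset.mem_insert_self T S)).pow l F (hle hl)

open Classical in
-- Regularity of c survives the extension of the chain because c, like the initials, can be
-- exchanged for a power of the new initial.
theorem RegularMod.sat_insert (hS : ∀ Q ∈ S, i ∉ Q.vars) (hTi : leadVar T = i)
    (hT : RegularMod (sat S) (initial T)) {c : MvPolynomial (Fin n) K}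
    (hc : RegularMod (sat S) c) (hci : i ∉ c.vars) : RegularMod (sat (insert T S)) c := by
  intro F hF
  rw [mem_sat_insert_iff hS hTi hT] at hF ⊢
  obtain ⟨l, hl⟩ := hF
  have hini := initial_eq_leadCoeffIn hTi
  rw [hini] at hT hl ⊢
  have hiv : i ∉ (leadCoeffIn i T).vars := fun h => (vars_leadCoeffIn h).1 rfl
  refine exists_pow_mul_mem_sup_span (coeffStable_sat hS) (leadVar_eq_coe_iff.mp hTi).1 hT
    ((hT.pow l).mul hc) (notMem_vars_mul (notMem_vars_pow hiv l) hci) ?_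
  rwa [mul_assoc]

open Classical in
-- The descent step on which all later degree comparisons rest: T cannot contribute to elements of
-- smaller degree in its leading variable.
theorem mem_sat_of_mem_sat_insert (hS : ∀ Q ∈ S, i ∉ Q.vars) (hTi : leadVar T = i)
    (hT : RegularMod (sat S) (initial T)) {F : MvPolynomial (Fin n) K}
    (hdeg : F.degreeOf i < T.degreeOf i) (hF : F ∈ sat (insert T S)) : F ∈ sat S := by
  rw [mem_sat_insert_iff hS hTi hT] at hF
  obtain ⟨l, hl⟩ := hF
  rw [initial_eq_leadCoeffIn hTi] at hT hl
  have hiv : i ∉ (leadCoeffIn i T).vars := fun h => (vars_leadCoeffIn h).1 rfl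
  exact mem_of_mul_mem_sup_span (coeffStable_sat hS) hT (hT.pow l) (notMem_vars_pow hiv l) hdeg hl

end Insert

open Classical in
/-- The members of `T` that involve only the first `m` variables. -/
noncomputable def chain (T : Finset (MvPolynomial (Fin n) K)) (m : ℕ) :
    Finset (MvPolynomial (Fin n) K) :=
  T.filter fun Q => ∀ v ∈ Q.vars, (v : ℕ) < m

theorem mem_chain {T : Finset (MvPolynomial (Fin n) K)} {m : ℕ} {Q : MvPolynomial (Fin n) K} :
    Q ∈ chain T m ↔ Q ∈ T ∧ ∀ v ∈ Q.vars, (v : ℕ) < m := by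
  classical
  simp [chain]

theorem chain_mono (T : Finset (MvPolynomial (Fin n) K)) {k m : ℕ} (h : k ≤ m) :
    chain T k ⊆ chain T m :=
  fun _ hQ => mem_chain.mpr
    ⟨(mem_chain.mp hQ).1, fun v hv => ((mem_chain.mp hQ).2 v hv).trans_le h⟩

theorem chain_top (T : Finset (MvPolynomial (Fin n) K)) : chain T n = T := by
  ext Q
  simp [mem_chain]

theorem notMem_vars_of_mem_chain {T : Finset (MvPolynomial (Fin n) K)} (i : Fin n) :
    ∀ Q ∈ chain T i, i ∉ Q.vars :=
  fun _ hQ hi => lt_irrefl _ ((mem_chain.mp hQ).2 i hi)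

theorem IsTriangularSet.chain_zero {T : Finset (MvPolynomial (Fin n) K)}
    (hT : IsTriangularSet T) : chain T 0 = ∅ := by
  rw [Finset.eq_empty_iff_forall_notMem]
  intro Q hQ
  obtain ⟨hQT, hv⟩ := mem_chain.mp hQ
  obtain ⟨i, hi⟩ := exists_leadVar_eq (hT.nonconstant Q hQT)
  exact absurd (hv i (leadVar_eq_coe_iff.mp hi).1) (by simp)

open Classical in
theorem IsTriangularSet.chain_succ {T : Finset (MvPolynomial (Fin n) K)}
    (hT : IsTriangularSet T) {P : MvPolynomial (Fin n) K} (hP : P ∈ T) {i : Fin n}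
    (hi : leadVar P = i) : chain T (i + 1) = insert P (chain T i) := by
  ext Q
  rw [Finset.mem_insert, mem_chain, mem_chain]
  constructor
  · rintro ⟨hQ, hv⟩
    by_cases h : i ∈ Q.vars
    · left
      refine hT.leadVar_injOn hQ hP (hi ▸ leadVar_eq_coe_iff.mpr ⟨h, fun j hj => ?_⟩)
      exact Fin.le_def.mpr (Nat.lt_succ_iff.mp (hv j hj))
    · refine Or.inr ⟨hQ, fun v hv' => lt_of_le_of_ne (Nat.lt_succ_iff.mp (hv v hv')) ?_⟩
      exact fun he => h (Fin.ext he ▸ hv')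
  · rintro (rfl | ⟨hQ, hv⟩)
    · exact ⟨hP, fun v hv => Nat.lt_succ_iff.mpr ((leadVar_eq_coe_iff.mp hi).2 v hv)⟩
    · exact ⟨hQ, fun v hv' => (hv v hv').trans (Nat.lt_succ_self _)⟩

theorem IsTriangularSet.chain_succ_of_isParameter {T : Finset (MvPolynomial (Fin n) K)}
    {i : Fin n} (hi : IsParameter T i) : chain T (i + 1) = chain T i := by
  refine Finset.Subset.antisymm (fun Q hQ => ?_) (chain_mono T (Nat.le_succ _))
  obtain ⟨hQT, hv⟩ := mem_chain.mp hQ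
  refine mem_chain.mpr ⟨hQT, fun v hv' => lt_of_le_of_ne (Nat.lt_succ_iff.mp (hv v hv')) ?_⟩
  intro he
  obtain rfl : v = i := Fin.ext he
  exact hi Q hQT (leadVar_eq_coe_iff.mpr
    ⟨hv', fun j hj => Fin.le_def.mpr (Nat.lt_succ_iff.mp (hv j hj))⟩)

/-- Brings the definition of regularity into a form suited to induction on the number of variables.
-/
theorem below_eq_chain {T : Finset (MvPolynomial (Fin n) K)} {P : MvPolynomial (Fin n) K}
    {i : Fin n} (hi : leadVar P = i) : below T P = chain T i := by
  classical
  ext Q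
  rw [mem_chain, below, Finset.mem_filter, hi]
  refine and_congr_right fun _ => ?_
  constructor
  · intro h v hv
    exact Fin.lt_def.mp (WithBot.coe_lt_coe.mp ((Finset.le_max hv).trans_lt h))
  · intro h
    by_cases hb : leadVar Q = ⊥
    · rw [hb]
      exact WithBot.bot_lt_coe i
    · obtain ⟨j, hj⟩ := exists_leadVar_eq hb
      rw [hj]
      exact WithBot.coe_lt_coe.mpr (h j (leadVar_eq_coe_iff.mp hj).1)

/-- Polynomials in the parameters of `T`. -/
noncomputable abbrev parameterRing (T : Finset (MvPolynomial (Fin n) K)) :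
    Subalgebra K (MvPolynomial (Fin n) K) :=
  supported K {v | IsParameter T v}

theorem isParameter_of_mem_vars {T : Finset (MvPolynomial (Fin n) K)}
    {q : MvPolynomial (Fin n) K} (hq : q ∈ parameterRing T) {v : Fin n} (hv : v ∈ q.vars) :
    IsParameter T v :=
  mem_supported.mp hq hv

namespace IsRegularSet

variable {T : Finset (MvPolynomial (Fin n) K)}

theorem regularMod_initial (hT : IsRegularSet T)
    {P : MvPolynomial (Fin n) K} (hP : P ∈ T) {i : Fin n}
    (hi : leadVar P = i) : RegularMod (sat (chain T i)) (initial P) := by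
  intro a ha
  have h := (hT.regular P hP).2
  rw [below_eq_chain hi] at h
  rw [← Ideal.Quotient.eq_zero_iff_mem]
  refine (mem_nonZeroDivisors_iff.mp h).1 _ ?_
  rwa [← map_mul, Ideal.Quotient.eq_zero_iff_mem]

/-- At the bottom of the chain the ideal is 0 in a domain. Each later member has a leading variable
that q does not involve, so `RegularMod.sat_insert` applies. -/
theorem regularMod_of_mem_parameterRing (hT : IsRegularSet T)
    {q : MvPolynomial (Fin n) K} (hq : q ∈ parameterRing T)
    (hq0 : q ≠ 0) {m : ℕ} (hm : m ≤ n) : RegularMod (sat (chain T m)) q := by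
  classical
  induction m with
  | zero =>
    rw [hT.isTriangularSet.chain_zero, sat_empty]
    intro a ha
    exact (mul_eq_zero.mp ha).resolve_left hq0
  | succ m ih =>
    by_cases hpar : IsParameter T ⟨m, hm⟩
    · have h := IsTriangularSet.chain_succ_of_isParameter hpar
      simp only at h
      rw [h]
      exact ih (by omega)
    · have hpar' := hpar
      unfold IsParameter at hpar'
      push Not at hpar'
      obtain ⟨P, hP, hi⟩ := hpar'
      have h := hT.isTriangularSet.chain_succ hP hi
      simp only at h
      rw [h]
      exact RegularMod.sat_insert (notMem_vars_of_mem_chain ⟨m, hm⟩) hi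
        (hT.regularMod_initial hP hi) (ih (by omega))
        fun hv => hpar (isParameter_of_mem_vars hq hv)

/-- Iterated descent, removing the members with the greatest leading variables one at a time. -/
theorem mem_sat_chain_of_degreeOf_lt (hT : IsRegularSet T)
    {F : MvPolynomial (Fin n) K} {k m : ℕ} (hkm : k ≤ m)
    (hm : m ≤ n) (hdeg : ∀ P ∈ T, ∀ i : Fin n, leadVar P = i → k ≤ i →
      (i : ℕ) < m → F.degreeOf i < P.degreeOf i) (hF : F ∈ sat (chain T m)) : F ∈ sat (chain T k) := by
  classical
  induction m, hkm using Nat.le_induction with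
  | base => exact hF
  | succ m hkm ih =>
    apply ih (by omega) fun P hP i hi hki him => hdeg P hP i hi hki (by omega)
    by_cases hpar : IsParameter T ⟨m, hm⟩
    · have h := IsTriangularSet.chain_succ_of_isParameter hpar
      simp only at h
      rwa [h] at hF
    · unfold IsParameter at hpar
      push Not at hpar
      obtain ⟨P, hP, hi⟩ := hpar
      have h := hT.isTriangularSet.chain_succ hP hi
      simp only at h
      rw [h] at hF
      exact mem_sat_of_mem_sat_insert (notMem_vars_of_mem_chain ⟨m, hm⟩) hi
        (hT.regularMod_initial hP hi) (hdeg P hP _ hi hkm (Nat.lt_succ_self m)) hF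

theorem mem_sat_chain_of_vars_lt (hT : IsRegularSet T)
    {F : MvPolynomial (Fin n) K} {k : ℕ} (hk : k ≤ n)
    (hv : ∀ v ∈ F.vars, (v : ℕ) < k) (hF : F ∈ sat T) : F ∈ sat (chain T k) := by
  refine hT.mem_sat_chain_of_degreeOf_lt hk le_rfl (fun P _ i hi hki _ => ?_)
    (by rwa [chain_top])
  have h0 : F.degreeOf i = 0 := by
    by_contra h
    exact absurd (hv i (mem_vars_iff_degreeOf_ne_zero.mpr h)) (by omega)
  rw [h0, degreeOf_pos_iff_mem_vars]
  exact (leadVar_eq_coe_iff.mp hi).1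

/-- Such an F has degree 0 in every leading variable, so the descent reaches the empty chain, whose
saturated ideal is 0. -/
theorem eq_zero_of_mem_parameterRing (hT : IsRegularSet T)
    {F : MvPolynomial (Fin n) K} (hF : F ∈ sat T)
    (hv : F ∈ parameterRing T) : F = 0 := by
  have h : F ∈ sat (chain T 0) := by
    refine hT.mem_sat_chain_of_degreeOf_lt (Nat.zero_le n) le_rfl (fun P hP i hi _ _ => ?_)
      (by rwa [chain_top])
    have h0 : F.degreeOf i = 0 := by
      by_contra h
      exact isParameter_of_mem_vars hv (mem_vars_iff_degreeOf_ne_zero.mpr h) P hP hi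
    rw [h0, degreeOf_pos_iff_mem_vars]
    exact (leadVar_eq_coe_iff.mp hi).1
  rwa [hT.isTriangularSet.chain_zero, sat_empty] at h

end IsRegularSet

/-- The substitution of `0` for the variables from `x_m` on. -/
noncomputable def truncateVars (m : ℕ) :
    MvPolynomial (Fin n) K →ₐ[K] MvPolynomial (Fin n) K :=
  aeval fun v => if (v : ℕ) < m then X v else 0

theorem truncateVars_eq_self {m : ℕ} {F : MvPolynomial (Fin n) K}
    (hF : ∀ v ∈ F.vars, (v : ℕ) < m) : truncateVars m F = F := by
  refine hom_congr_vars (f₁ := (truncateVars m : MvPolynomial (Fin n) K →ₐ[K] _).toRingHom)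
    (f₂ := RingHom.id _) ?_ ?_ rfl
  · ext a : 1
    exact (truncateVars m).commutes a
  · intro j hj _
    simp [truncateVars, hF j hj]

theorem vars_truncateVars {m : ℕ} (F : MvPolynomial (Fin n) K) :
    ∀ v ∈ (truncateVars m F).vars, (v : ℕ) < m := by
  have h : truncateVars m F ∈ supported K {v : Fin n | (v : ℕ) < m} := by
    induction F using MvPolynomial.induction_on with
    | C a => rw [← algebraMap_eq, AlgHom.commutes]; exact Subalgebra.algebraMap_mem _ _
    | add p q hp hq => rw [map_add]; exact Subalgebra.add_mem _ hp hq
    | mul_X p v hp =>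
      rw [map_mul]
      refine Subalgebra.mul_mem _ hp ?_
      rw [truncateVars, aeval_X]
      split_ifs with hv
      · exact X_mem_supported.mpr hv
      · exact Subalgebra.zero_mem _
  exact fun v hv => mem_supported.mp h hv

/-- The substitution fixes the members of the chain and their initials, hence preserves any witness
of membership. It serves to rid cofactors of superfluous variables. -/
theorem truncateVars_mem_sat_chain {T : Finset (MvPolynomial (Fin n) K)} {m : ℕ}
    {F : MvPolynomial (Fin n) K} (hF : F ∈ sat (chain T m)) :
    truncateVars m F ∈ sat (chain T m) := by
  classical
  obtain ⟨k, hk⟩ := hF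
  refine ⟨k, ?_⟩
  have hJ : truncateVars m (∏ Q ∈ chain T m, initial Q) = ∏ Q ∈ chain T m, initial Q := by
    rw [map_prod]
    refine Finset.prod_congr rfl fun Q hQ => truncateVars_eq_self fun v hv => ?_
    exact (mem_chain.mp hQ).2 v (vars_initial_subset Q hv)
  have h := Ideal.mem_map_of_mem (truncateVars m : MvPolynomial (Fin n) K →ₐ[K] _) hk
  rw [map_mul, map_pow, hJ, Ideal.map_span] at h
  refine Ideal.span_mono ?_ h
  rintro _ ⟨Q, hQ, rfl⟩
  have := truncateVars_eq_self (mem_chain.mp hQ).2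
  rw [this]
  exact hQ

end Chains

/-! ### Elements of the saturated ideal with initials in the parameters -/

section NormalMembers

variable {K : Type*} [Field K] {n : ℕ} {T : Finset (MvPolynomial (Fin n) K)}

/-- `N` has the leading variable and the degree of a member of `T` with leading variable `x_i`, but
its initial involves parameters only. -/
structure IsNormalMember (T : Finset (MvPolynomial (Fin n) K)) (i : Fin n) (d : ℕ)
    (N : MvPolynomial (Fin n) K) : Prop where
  mem : N ∈ sat (chain T (i + 1))
  ne_zero : N ≠ 0
  degreeOf_eq : N.degreeOf i = d
  vars_le : ∀ v ∈ N.vars, v ≤ i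
  leadCoeffIn_mem : leadCoeffIn i N ∈ parameterRing T

theorem mk_isAlgebraic_of_vars {I : Ideal (MvPolynomial (Fin n) K)}
    {F : MvPolynomial (Fin n) K}
    (h : ∀ v ∈ F.vars, IsAlgebraic (parameterRing T) (Ideal.Quotient.mk I (X v))) :
    IsAlgebraic (parameterRing T) (Ideal.Quotient.mk I F) := by
  suffices key : ∀ G ∈ Algebra.adjoin K (X '' (F.vars : Set (Fin n))),
      IsAlgebraic (parameterRing T) (Ideal.Quotient.mk I G) from key F (mem_supported_vars F)
  intro G hG
  induction hG using Algebra.adjoin_induction with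
  | mem x hx =>
    obtain ⟨v, hv, rfl⟩ := hx
    exact h v hv
  | algebraMap r =>
    exact isAlgebraic_algebraMap (A := MvPolynomial (Fin n) K ⧸ I)
      (algebraMap K (parameterRing T) r)
  | add x y _ _ hx hy => rw [map_add]; exact hx.add hy
  | mul x y _ _ hx hy => rw [map_mul]; exact hx.mul hy

/-- Modulo I, N is an equation for x_i whose coefficients are algebraic and whose top coefficient is
a nonzero parameter polynomial. -/
theorem IsNormalMember.isAlgebraic_X {i : Fin n} {d : ℕ} {N : MvPolynomial (Fin n) K}
    (hN : IsNormalMember T i d N) {I : Ideal (MvPolynomial (Fin n) K)}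
    (hI : sat (chain T (i + 1)) ≤ I)
    (h : ∀ v < i, IsAlgebraic (parameterRing T) (Ideal.Quotient.mk I (X v))) :
    IsAlgebraic (parameterRing T) (Ideal.Quotient.mk I (X i)) := by
  set π := Ideal.Quotient.mk I with hπ
  set q : parameterRing T := ⟨leadCoeffIn i N, hN.leadCoeffIn_mem⟩ with hq
  have hq0 : q ≠ 0 := fun h0 => leadCoeffIn_ne_zero hN.ne_zero (congrArg Subtype.val h0)
  have hroot : ((toUnivariate i N).map π).eval (π (X i)) = 0 := by
    rw [Polynomial.eval_map, Polynomial.eval₂_at_apply, eval_toUnivariate, hπ,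
      Ideal.Quotient.eq_zero_iff_mem]
    exact hI hN.mem
  have hcoeff : ∀ k, IsAlgebraic (parameterRing T) (((toUnivariate i N).map π).coeff k) := by
    intro k
    rw [Polynomial.coeff_map]
    refine mk_isAlgebraic_of_vars fun v hv => h v ?_
    obtain ⟨h1, h2⟩ := vars_coeff_toUnivariate hv
    exact lt_of_le_of_ne (hN.vars_le v h2) h1
  have halg : π (leadCoeffIn i N) = algebraMap (parameterRing T) _ q := rfl
  -- If the initial q vanishes modulo I, the degree may drop, but then the constant polynomial q is
  -- itself an algebraic relation for x_i.
  by_cases h0 : π (leadCoeffIn i N) = 0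
  · refine ⟨Polynomial.C q, Polynomial.C_ne_zero.mpr hq0, ?_⟩
    rw [Polynomial.aeval_C, ← halg, h0]
  · refine isAlgebraic_of_eval_eq_zero hroot hcoeff hq0 ?_
    rw [← Polynomial.leadingCoeff, ← halg, leadCoeffIn_eq_leadingCoeff]
    refine Polynomial.leadingCoeff_map_of_leadingCoeff_ne_zero π ?_
    rwa [← leadCoeffIn_eq_leadingCoeff]

/-- The initial of P is algebraic over the parameters and regular modulo the earlier chain, so it
divides a nonzero parameter polynomial there. The cofactor turns P into the required element. -/
theorem IsRegularSet.exists_isNormalMember (hT : IsRegularSet T)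
    (hvar : VariableOrderingCondition T) {P : MvPolynomial (Fin n) K} (hP : P ∈ T) {i : Fin n}
    (hi : leadVar P = i) : ∃ N, IsNormalMember T i (P.degreeOf i) N := by
  induction i using WellFoundedLT.induction generalizing P with
  | _ i ih =>
    set I := sat (chain T i) with hI
    -- Parameters are algebraic trivially. Any other smaller variable is a root of its own normal
    -- member, supplied by the outer induction.
    have hX : ∀ v < i, IsAlgebraic (parameterRing T) (Ideal.Quotient.mk I (X v)) := by
      intro v
      induction v using WellFoundedLT.induction with
      | _ v ihv =>
        intro hv
        by_cases hpar : IsParameter T v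
        · exact isAlgebraic_algebraMap (A := MvPolynomial (Fin n) K ⧸ I)
            (⟨X v, X_mem_supported.mpr hpar⟩ : parameterRing T)
        · unfold IsParameter at hpar
          push Not at hpar
          obtain ⟨Q, hQ, hQv⟩ := hpar
          obtain ⟨N, hN⟩ := ih v hv hQ hQv
          exact hN.isAlgebraic_X (sat_mono (chain_mono T hv)) fun w hw => ihv w hw (hw.trans hv)
    have hPv := leadVar_eq_coe_iff.mp hi
    have hh := hT.regularMod_initial hP hi
    rw [initial_eq_leadCoeffIn hi] at hh
    set h := leadCoeffIn i P with hhdef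
    have hhv : ∀ v ∈ h.vars, v < i := fun v hv =>
      lt_of_le_of_ne (hPv.2 v (vars_leadCoeffIn hv).2) (vars_leadCoeffIn hv).1
    have halg : IsAlgebraic (parameterRing T) (Ideal.Quotient.mk I h) :=
      mk_isAlgebraic_of_vars fun v hv => hX v (hhv v hv)
    have hnzd : Ideal.Quotient.mk I h ∈ nonZeroDivisors (MvPolynomial (Fin n) K ⧸ I) := by
      rw [mem_nonZeroDivisors_iff_right]
      intro x hx
      obtain ⟨a, rfl⟩ := Ideal.Quotient.mk_surjective x
      rw [← map_mul, Ideal.Quotient.eq_zero_iff_mem] at hx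
      rw [Ideal.Quotient.eq_zero_iff_mem]
      exact hh a (by rwa [mul_comm])
    obtain ⟨q, hq0, y, hy⟩ := halg.exists_nonzero_dvd hnzd
    obtain ⟨g, rfl⟩ := Ideal.Quotient.mk_surjective y
    have hgq : (q : MvPolynomial (Fin n) K) - h * g ∈ I := by
      rw [← Ideal.Quotient.eq_zero_iff_mem, map_sub, map_mul, ← hy, sub_eq_zero]
      rfl
    -- The variable ordering condition places all parameters below x_i, so the truncation below x_i
    -- fixes q.
    have hqv : ∀ v ∈ (q : MvPolynomial (Fin n) K).vars, v < i := by
      intro v hv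
      have := hvar v (isParameter_of_mem_vars q.2 hv) P hP
      rw [hi] at this
      exact WithBot.coe_lt_coe.mp this
    replace hgq := truncateVars_mem_sat_chain hgq
    rw [map_sub, map_mul, truncateVars_eq_self hqv, truncateVars_eq_self hhv] at hgq
    set g' := truncateVars (i : ℕ) g with hg'
    have hg'v : ∀ v ∈ g'.vars, v < i := vars_truncateVars g
    set c := (q : MvPolynomial (Fin n) K) - h * g' with hc
    have hcv : ∀ v ∈ c.vars, v < i := by
      intro v hv
      rcases Finset.mem_union.mp (vars_sub_subset (p := (q : MvPolynomial (Fin n) K)) hv)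
        with h1 | h1
      · exact hqv v h1
      · rcases Finset.mem_union.mp (vars_mul _ _ h1) with h2 | h2
        · exact hhv v h2
        · exact hg'v v h2
    set d := P.degreeOf i with hd
    -- The multiple g' P has top coefficient g' h. Adding c x_i^d with c = q - h g', an element of
    -- the ideal, changes it to exactly q without raising the degree.
    have hφ : toUnivariate i (g' * P + c * X i ^ d) =
        Polynomial.C g' * toUnivariate i P + Polynomial.C c * Polynomial.X ^ d := by
      rw [map_add, map_mul, map_mul, map_pow, toUnivariate_X_self,
        toUnivariate_of_notMem_vars fun hv => lt_irrefl _ (hg'v i hv),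
        toUnivariate_of_notMem_vars fun hv => lt_irrefl _ (hcv i hv)]
    have hcoeff : (toUnivariate i (g' * P + c * X i ^ d)).coeff d = q := by
      rw [hφ, Polynomial.coeff_add, Polynomial.coeff_C_mul, Polynomial.coeff_C_mul_X_pow,
        if_pos rfl, hd, ← natDegree_toUnivariate, Polynomial.coeff_natDegree,
        ← leadCoeffIn_eq_leadingCoeff, hc]
      ring
    have hq0' : (q : MvPolynomial (Fin n) K) ≠ 0 := fun h0 => hq0 (Subtype.ext h0)
    have hdeg : (toUnivariate i (g' * P + c * X i ^ d)).natDegree = d := by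
      refine le_antisymm ?_ (Polynomial.le_natDegree_of_ne_zero (hcoeff ▸ hq0'))
      rw [hφ]
      refine Polynomial.natDegree_add_le_of_degree_le ?_ (Polynomial.natDegree_C_mul_X_pow_le _ _)
      exact (Polynomial.natDegree_C_mul_le _ _).trans (natDegree_toUnivariate i P).le
    refine ⟨g' * P + c * X i ^ d, ?_, ?_, ?_, ?_, ?_⟩
    · refine Ideal.add_mem _ (Ideal.mul_mem_left _ _ (span_le_sat _ (Ideal.subset_span ?_)))
        (Ideal.mul_mem_right _ _ (sat_mono (chain_mono T (Nat.le_succ _)) hgq))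
      exact mem_chain.mpr ⟨hP, fun v hv => Nat.lt_succ_iff.mpr (hPv.2 v hv)⟩
    · intro h0
      rw [h0] at hcoeff
      exact hq0' (by simpa using hcoeff.symm)
    · rw [← natDegree_toUnivariate, hdeg]
    · intro v hv
      rcases Finset.mem_union.mp (vars_add_subset _ _ hv) with h1 | h1
      · rcases Finset.mem_union.mp (vars_mul _ _ h1) with h2 | h2
        · exact (hg'v v h2).le
        · exact hPv.2 v h2
      · rcases Finset.mem_union.mp (vars_mul _ _ h1) with h2 | h2
        · exact (hcv v h2).le
        · have h3 := vars_pow _ _ h2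
          rw [vars_X, Finset.mem_singleton] at h3
          exact h3.le
    · rw [leadCoeffIn_eq_leadingCoeff, Polynomial.leadingCoeff, hdeg, hcoeff]
      exact q.2

end NormalMembers

/-! ### Exponents of lexicographic leading monomials -/

section LexOrder

variable {K : Type*} [Field K] {n : ℕ}

theorem lexOrder_le_cases {a b : Fin n →₀ ℕ} (h : (lexOrder n).toSyn a ≤ (lexOrder n).toSyn b) :
    a = b ∨ ∃ i, (∀ j, i < j → a j = b j) ∧ a i < b i := by
  rcases eq_or_lt_of_le h with h | h
  · exact Or.inl ((lexOrder n).toSyn.injective h)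
  · exact Or.inr (Finsupp.Colex.lt_iff.mp h)

theorem apply_le_of_lexOrder_le {a b : Fin n →₀ ℕ}
    (h : (lexOrder n).toSyn a ≤ (lexOrder n).toSyn b) {i : Fin n}
    (hab : ∀ j, i < j → a j = b j) : a i ≤ b i := by
  rcases lexOrder_le_cases h with rfl | ⟨k, h1, h2⟩
  · exact le_rfl
  · rcases lt_trichotomy k i with hk | rfl | hk
    · exact (h1 i hk).le
    · exact h2.le
    · exact absurd (hab k hk) h2.ne

/-- The greatest variable in which a and b differ is below x_i. It cannot lie in [x_j, x_i), where b
vanishes and a would have to be smaller still, so a and b agree at x_j. -/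
theorem eq_zero_of_lexOrder_le_of_agree {a b : Fin n →₀ ℕ}
    (h : (lexOrder n).toSyn a ≤ (lexOrder n).toSyn b) {i j : Fin n} (hji : j < i)
    (hab : ∀ k, i ≤ k → a k = b k) (hb : ∀ k, j ≤ k → k < i → b k = 0) : a j = 0 := by
  rcases lexOrder_le_cases h with rfl | ⟨k, h1, h2⟩
  · exact hb j le_rfl hji
  · rcases lt_or_ge k i with hk | hk
    · rcases lt_or_ge k j with hkj | hkj
      · rw [h1 j hkj, hb j le_rfl hji]
      · rw [hb k hkj hk] at h2
        exact absurd h2 (Nat.not_lt_zero _)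
    · exact absurd (hab k hk) h2.ne

variable {P : MvPolynomial (Fin n) K} {i : Fin n}

theorem apply_eq_zero_of_vars_le (hv : ∀ v ∈ P.vars, v ≤ i) {d : Fin n →₀ ℕ} (hd : d ∈ P.support)
    (j : Fin n) (hj : i < j) : d j = 0 :=
  mem_support_notMem_vars_zero hd fun h => (hv j h).not_gt hj

/-- No variable above x_i occurs, so the lexicographic comparison of terms begins with the exponent
of x_i. -/
theorem lexOrder_degree_apply (hP : P ≠ 0) (hv : ∀ v ∈ P.vars, v ≤ i) :
    (lexOrder n).degree P i = P.degreeOf i := by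
  have hmem := (lexOrder n).degree_mem_support hP
  refine le_antisymm (monomial_le_degreeOf i hmem) ?_
  rw [degreeOf_le_iff]
  intro d hd
  refine apply_le_of_lexOrder_le ((lexOrder n).le_degree hd) fun j hj => ?_
  rw [apply_eq_zero_of_vars_le hv hd j hj, apply_eq_zero_of_vars_le hv hmem j hj]

theorem ne_zero_of_leadVar_eq (h : leadVar P = i) : P ≠ 0 := by
  rintro rfl
  have := (leadVar_eq_coe_iff.mp h).1
  simp at this

theorem degreeOf_pos_of_leadVar_eq (h : leadVar P = i) : 0 < P.degreeOf i :=
  degreeOf_pos_iff_mem_vars.mpr (leadVar_eq_coe_iff.mp h).1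

end LexOrder

/-! ### Reduced Gröbner bases generate their ideals -/

section GroebnerBasis

variable {K : Type*} [Field K] {n : ℕ}

theorem groebnerBasis_isReduced (I : Ideal (MvPolynomial (Fin n) K)) :
    IsReducedGroebnerBasis (groebnerBasis I) I :=
  (existsUnique_isReducedGroebnerBasis I).choose_spec.1

theorem groebnerBasis_subset {I : Ideal (MvPolynomial (Fin n) K)} {P : MvPolynomial (Fin n) K}
    (hP : P ∈ groebnerBasis I) : P ∈ I :=
  (groebnerBasis_isReduced I).isGroebnerBasis.subset hP

theorem exists_groebnerBasis_degree_le {I : Ideal (MvPolynomial (Fin n) K)}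
    {F : MvPolynomial (Fin n) K} (hF : F ∈ I) (hF0 : F ≠ 0) :
    ∃ P ∈ groebnerBasis I, (lexOrder n).degree P ≤ (lexOrder n).degree F :=
  ((isGroebnerBasis_iff_of_monic (groebnerBasis_isReduced I).monic).mp
    (groebnerBasis_isReduced I).isGroebnerBasis).2 F hF hF0

/-- The remainder of an element of I on division by the basis lies in I, and if nonzero its leading
term would be divisible by that of a basis member. -/
theorem span_groebnerBasis (I : Ideal (MvPolynomial (Fin n) K)) :
    Ideal.span (groebnerBasis I : Set (MvPolynomial (Fin n) K)) = I := by
  refine le_antisymm (Ideal.span_le.mpr fun P hP => groebnerBasis_subset hP) fun F hF => ?_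
  obtain ⟨g, r, h1, -, h3⟩ := (lexOrder n).div_set
    (B := (groebnerBasis I : Set (MvPolynomial (Fin n) K)))
    (fun b hb => by
      rw [((groebnerBasis_isReduced I).monic b hb).leadingCoeff_eq_one]
      exact isUnit_one) F
  have hspan : Finsupp.linearCombination (MvPolynomial (Fin n) K)
      (fun b : (groebnerBasis I : Set (MvPolynomial (Fin n) K)) =>
        (b : MvPolynomial (Fin n) K)) g ∈
      Ideal.span (groebnerBasis I : Set (MvPolynomial (Fin n) K)) := by
    rw [Finsupp.linearCombination_apply]
    exact Ideal.sum_mem _ fun b _ => Ideal.mul_mem_left _ _ (Ideal.subset_span b.2)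
  have hr : r ∈ I := by
    rw [show r = F - Finsupp.linearCombination (MvPolynomial (Fin n) K)
      (fun b : (groebnerBasis I : Set (MvPolynomial (Fin n) K)) =>
        (b : MvPolynomial (Fin n) K)) g from eq_sub_of_add_eq' h1.symm]
    exact I.sub_mem hF (Ideal.span_le.mpr (fun P hP => groebnerBasis_subset hP) hspan)
  have hr0 : r = 0 := by
    by_contra hr0
    obtain ⟨P, hP, hle⟩ := exists_groebnerBasis_degree_le hr hr0
    exact h3 _ ((lexOrder n).degree_mem_support hr0) P hP hle
  rw [h1, hr0, add_zero]
  exact hspan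

end GroebnerBasis

/-! ### Elementary properties of W-characteristic sets -/

section WCharSet

variable {K : Type*} [Field K] {n : ℕ}

theorem mem_wCharSet {I : Ideal (MvPolynomial (Fin n) K)} {P : MvPolynomial (Fin n) K} :
    P ∈ wCharSet I ↔ P ∈ groebnerBasis I ∧ (leadVar P = ⊥ ∨
      ∀ Q ∈ groebnerBasis I, leadVar Q = leadVar P →
        (lexOrder n).toSyn ((lexOrder n).degree P) ≤
          (lexOrder n).toSyn ((lexOrder n).degree Q)) := by
  classical
  simp [wCharSet]

theorem exists_mem_wCharSet {I : Ideal (MvPolynomial (Fin n) K)} {g : MvPolynomial (Fin n) K}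
    (hg : g ∈ groebnerBasis I) : ∃ Q ∈ wCharSet I, leadVar Q = leadVar g := by
  classical
  obtain ⟨Q, hQ, hmin⟩ := Finset.exists_min_image
    ((groebnerBasis I).filter fun P => leadVar P = leadVar g)
    (fun P => (lexOrder n).toSyn ((lexOrder n).degree P)) ⟨g, by simp [hg]⟩
  rw [Finset.mem_filter] at hQ
  refine ⟨Q, mem_wCharSet.mpr ⟨hQ.1, Or.inr fun R hR hRQ => hmin R ?_⟩, hQ.2⟩
  rw [Finset.mem_filter]
  exact ⟨hR, hRQ.trans hQ.2⟩

/-- Both are minimal, so their leading monomials coincide, which reducedness forbids for distinct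
members. -/
theorem wCharSet_eq_of_leadVar_eq {I : Ideal (MvPolynomial (Fin n) K)}
    {P Q : MvPolynomial (Fin n) K} (hP : P ∈ wCharSet I) (hQ : Q ∈ wCharSet I)
    (hPn : leadVar P ≠ ⊥) (h : leadVar P = leadVar Q) : P = Q := by
  obtain ⟨hPG, hP⟩ := mem_wCharSet.mp hP
  obtain ⟨hQG, hQ⟩ := mem_wCharSet.mp hQ
  have h1 := hP.resolve_left hPn Q hQG h.symm
  have h2 := hQ.resolve_left (h ▸ hPn) P hPG h
  have hdeg := (lexOrder n).toSyn.injective (le_antisymm h1 h2)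
  by_contra hne
  have hG := groebnerBasis_isReduced I
  exact hG.reduced Q hQG P hPG hne _
    ((lexOrder n).degree_mem_support (hG.monic Q hQG).ne_zero) hdeg.le

end WCharSet

/-! ### The W-characteristic set of the saturated ideal of a regular set -/

namespace IsRegularSet

variable {K : Type*} [Field K] {n : ℕ} {T : Finset (MvPolynomial (Fin n) K)}

/-- If the greatest variable of F were a parameter, the ordering condition would make all its
variables parameters, and the ideal contains no nonzero parameter polynomial. -/
theorem exists_leadVar_eq_of_mem_sat (hT : IsRegularSet T) (hvar : VariableOrderingCondition T)
    {F : MvPolynomial (Fin n) K} (hF : F ∈ sat T) (hF0 : F ≠ 0) :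
    ∃ P ∈ T, ∃ i : Fin n, leadVar P = i ∧ leadVar F = i := by
  by_contra hcon
  refine hF0 (hT.eq_zero_of_mem_parameterRing hF (mem_supported.mpr fun v hv P hP hPv => ?_))
  have hbot : leadVar F ≠ ⊥ := fun h => by
    rw [leadVar, Finset.max_eq_bot] at h
    rw [h] at hv
    exact absurd hv (Finset.notMem_empty v)
  obtain ⟨l, hl⟩ := exists_leadVar_eq hbot
  have hpar : IsParameter T l := fun Q hQ hQl => hcon ⟨Q, hQ, l, hQl, hl⟩
  have hlt := hvar l hpar P hP
  rw [hPv] at hlt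
  exact ((leadVar_eq_coe_iff.mp hl).2 v hv).not_gt (WithBot.coe_lt_coe.mp hlt)

/-- The leading monomial of a normal member is a power of x_i times parameters, and g is a basis
member whose leading monomial divides it. -/
theorem exists_mem_groebnerBasis (hT : IsRegularSet T) (hvar : VariableOrderingCondition T)
    {P : MvPolynomial (Fin n) K} (hP : P ∈ T) {i : Fin n} (hi : leadVar P = i) :
    ∃ g ∈ groebnerBasis (sat T), leadVar g = i ∧
      (lexOrder n).degree g i ≤ P.degreeOf i ∧
      ∀ j, j ≠ i → ¬ IsParameter T j → (lexOrder n).degree g j = 0 := by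
  obtain ⟨N, hN⟩ := hT.exists_isNormalMember hvar hP hi
  have hNT : N ∈ sat T := by
    have h := sat_mono (chain_mono T i.isLt) hN.mem
    rwa [chain_top] at h
  obtain ⟨g, hg, hle⟩ := exists_groebnerBasis_degree_le hNT hN.ne_zero
  have hNmem := (lexOrder n).degree_mem_support hN.ne_zero
  have hNi := lexOrder_degree_apply hN.ne_zero hN.vars_le
  have hNj : ∀ j, j ≠ i → ¬ IsParameter T j → (lexOrder n).degree N j = 0 := by
    intro j hj hjp
    have hmem := erase_mem_support_coeff_toUnivariate i hNmem
    rw [hNi, ← natDegree_toUnivariate, Polynomial.coeff_natDegree,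
      ← leadCoeffIn_eq_leadingCoeff] at hmem
    have h0 := mem_support_notMem_vars_zero hmem
      fun h => hjp (isParameter_of_mem_vars hN.leadCoeffIn_mem h)
    rwa [Finsupp.erase_ne hj] at h0
  have hg0 : g ≠ 0 := ((groebnerBasis_isReduced _).monic g hg).ne_zero
  obtain ⟨Q, hQ, l, hQl, hgl⟩ := hT.exists_leadVar_eq_of_mem_sat hvar (groebnerBasis_subset hg) hg0
  -- The leading variable of g is not a parameter and occurs in its leading monomial, hence in that
  -- of N, where x_i is the only variable that is not a parameter.
  have hli : l = i := by
    by_contra hne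
    have h1 := hle l
    rw [hNj l hne fun h => h Q hQ hQl, lexOrder_degree_apply hg0 (leadVar_eq_coe_iff.mp hgl).2]
      at h1
    exact absurd (degreeOf_pos_of_leadVar_eq hgl) (by omega)
  subst hli
  refine ⟨g, hg, hgl, ?_, fun j hj hjp => ?_⟩
  · rw [← hN.degreeOf_eq, ← hNi]
    exact hle l
  · exact Nat.le_zero.mp (hNj j hj hjp ▸ hle j)

/-- If Q had smaller degree, it would descend to the chain below x_i, whose saturated ideal contains
the coefficients of its elements. The initial of Q would then lie in sat(T), making Q reducible by
another basis member. -/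
theorem degreeOf_le_of_mem_groebnerBasis (hT : IsRegularSet T) {P : MvPolynomial (Fin n) K}
    (hP : P ∈ T) {i : Fin n} (hi : leadVar P = i) {Q : MvPolynomial (Fin n) K}
    (hQ : Q ∈ groebnerBasis (sat T)) (hQi : leadVar Q = i) :
    P.degreeOf i ≤ Q.degreeOf i := by
  by_contra hlt
  rw [not_le] at hlt
  have hQv := leadVar_eq_coe_iff.mp hQi
  have hmem : Q ∈ sat (chain T i) := by
    refine hT.mem_sat_chain_of_degreeOf_lt i.isLt.le le_rfl (fun R hR j hj hij _ => ?_)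
      (by rw [chain_top]; exact groebnerBasis_subset hQ)
    rcases eq_or_lt_of_le (Fin.le_def.mpr hij) with rfl | hij
    · rwa [hT.isTriangularSet.leadVar_injOn hR hP (hj.trans hi.symm)]
    · have h0 : Q.degreeOf j = 0 := by
        by_contra h
        exact (hQv.2 j (mem_vars_iff_degreeOf_ne_zero.mpr h)).not_gt hij
      rw [h0]
      exact degreeOf_pos_of_leadVar_eq hj
  have hini : leadCoeffIn i Q ∈ sat T := by
    rw [leadCoeffIn_eq_leadingCoeff]
    have h := sat_mono (chain_mono T i.isLt.le)
      (coeffStable_sat (notMem_vars_of_mem_chain i) Q hmem (toUnivariate i Q).natDegree)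
    rwa [chain_top] at h
  have hini0 : leadCoeffIn i Q ≠ 0 := leadCoeffIn_ne_zero (ne_zero_of_leadVar_eq hQi)
  obtain ⟨g, hg, hle⟩ := exists_groebnerBasis_degree_le hini hini0
  have hε := (lexOrder n).degree_mem_support hini0
  have hε0 := mem_support_notMem_vars_zero hε fun h => (vars_leadCoeffIn h).1 rfl
  rw [leadCoeffIn_eq_leadingCoeff] at hε
  have hsupp := (support_coeff_toUnivariate hε).2
  rw [← leadCoeffIn_eq_leadingCoeff] at hsupp
  -- The leading monomial of g divides one of the initial of Q and is thus free of x_i, unlike the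
  -- leading monomial of Q.
  have hne : g ≠ Q := by
    rintro rfl
    have h1 := hle i
    rw [hε0, lexOrder_degree_apply (ne_zero_of_leadVar_eq hQi) hQv.2] at h1
    exact absurd (degreeOf_pos_of_leadVar_eq hQi) (by omega)
  exact (groebnerBasis_isReduced _).reduced Q hQ g hg hne _ hsupp (hle.trans le_self_add)

/-- By minimality Q is at most the g of `exists_mem_groebnerBasis`, which squeezes its degree. Every
term of Q of top degree in x_i is then at most a power of x_i times parameters, with the same power
of x_i. -/
theorem wCharSet_member (hT : IsRegularSet T) (hvar : VariableOrderingCondition T)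
    {P : MvPolynomial (Fin n) K} (hP : P ∈ T) {i : Fin n} (hi : leadVar P = i)
    {Q : MvPolynomial (Fin n) K} (hQ : Q ∈ wCharSet (sat T)) (hQi : leadVar Q = i) :
    Q.degreeOf i = P.degreeOf i ∧ initial Q ∈ parameterRing T := by
  obtain ⟨hQG, hmin⟩ := mem_wCharSet.mp hQ
  obtain ⟨g, hg, hgi, hgle, hgj⟩ := hT.exists_mem_groebnerBasis hvar hP hi
  have hle := hmin.resolve_left (by rw [hQi]; exact WithBot.coe_ne_bot) g hg (hgi.trans hQi.symm)
  have hQ0 := ne_zero_of_leadVar_eq hQi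
  have hQv := (leadVar_eq_coe_iff.mp hQi).2
  have hgtop := apply_eq_zero_of_vars_le (leadVar_eq_coe_iff.mp hgi).2
    ((lexOrder n).degree_mem_support (ne_zero_of_leadVar_eq hgi))
  have hPQ := hT.degreeOf_le_of_mem_groebnerBasis hP hi hQG hQi
  have hQg : Q.degreeOf i ≤ (lexOrder n).degree g i := by
    rw [← lexOrder_degree_apply hQ0 hQv]
    refine apply_le_of_lexOrder_le hle fun j hj => ?_
    rw [apply_eq_zero_of_vars_le hQv ((lexOrder n).degree_mem_support hQ0) j hj, hgtop j hj]
  refine ⟨by omega, mem_supported.mpr fun j hj => ?_⟩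
  rw [initial_eq_leadCoeffIn hQi] at hj
  obtain ⟨hji, hjQ⟩ := vars_leadCoeffIn hj
  by_contra hjp
  obtain ⟨ε, hε, hjε⟩ := (mem_vars_iff_mem_support j).mp hj
  rw [leadCoeffIn_eq_leadingCoeff] at hε
  obtain ⟨hε0, hsupp⟩ := support_coeff_toUnivariate hε
  rw [natDegree_toUnivariate] at hsupp
  -- The term of Q is ε + d e_i, with d the common degree in x_i. It agrees with the leading
  -- monomial of g from x_i on, so x_j cannot occur in ε.
  have hzero := eq_zero_of_lexOrder_le_of_agree (i := i) (j := j)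
    (((lexOrder n).le_degree hsupp).trans hle) (lt_of_le_of_ne (hQv j hjQ) hji) ?_ ?_
  · rw [Finsupp.add_apply, Finsupp.single_eq_of_ne hji, add_zero] at hzero
    exact Finsupp.mem_support_iff.mp hjε hzero
  · intro k hk
    rcases eq_or_lt_of_le hk with rfl | hk
    · rw [Finsupp.add_apply, hε0, Finsupp.single_eq_same]
      omega
    · rw [apply_eq_zero_of_vars_le hQv hsupp k hk, hgtop k hk]
  -- Since x_j is a leading variable and parameters lie below all of those, no x_k with j ≤ k < i is
  -- a parameter.
  · intro k hjk hki
    refine hgj k hki.ne fun hk => hjp fun R hR hRj => ?_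
    have hlt := hvar k hk R hR
    rw [hRj] at hlt
    exact hjk.not_gt (WithBot.coe_lt_coe.mp hlt)

theorem exists_leadVar_eq_of_mem_wCharSet (hT : IsRegularSet T)
    (hvar : VariableOrderingCondition T) {Q : MvPolynomial (Fin n) K}
    (hQ : Q ∈ wCharSet (sat T)) : ∃ P ∈ T, ∃ i : Fin n, leadVar P = i ∧ leadVar Q = i :=
  have hQG := (mem_wCharSet.mp hQ).1
  hT.exists_leadVar_eq_of_mem_sat hvar (groebnerBasis_subset hQG)
    ((groebnerBasis_isReduced _).monic Q hQG).ne_zero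

theorem exists_mem_wCharSet (hT : IsRegularSet T) (hvar : VariableOrderingCondition T)
    {P : MvPolynomial (Fin n) K} (hP : P ∈ T) {i : Fin n} (hi : leadVar P = i) :
    ∃ Q ∈ wCharSet (sat T), leadVar Q = i := by
  obtain ⟨g, hg, hgi, -⟩ := hT.exists_mem_groebnerBasis hvar hP hi
  rw [← hgi]
  exact TriangularDecomposition.exists_mem_wCharSet hg

theorem isNormalSet_wCharSet (hT : IsRegularSet T) (hvar : VariableOrderingCondition T) :
    IsNormalSet (wCharSet (sat T)) := by
  have hnonconst : ∀ Q ∈ wCharSet (sat T), leadVar Q ≠ ⊥ := by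
    intro Q hQ
    obtain ⟨P, -, i, -, hQi⟩ := hT.exists_leadVar_eq_of_mem_wCharSet hvar hQ
    rw [hQi]
    exact WithBot.coe_ne_bot
  refine ⟨⟨?_, hnonconst, fun P hP Q hQ h => wCharSet_eq_of_leadVar_eq hP hQ (hnonconst P hP) h⟩,
    ?_⟩
  · obtain ⟨P, hP⟩ := hT.isTriangularSet.nonempty
    obtain ⟨i, hi⟩ := exists_leadVar_eq (hT.isTriangularSet.nonconstant P hP)
    obtain ⟨Q, hQ, -⟩ := hT.exists_mem_wCharSet hvar hP hi
    exact ⟨Q, hQ⟩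
  · intro Q hQ v hv R hR hRv
    obtain ⟨P, hP, i, hPi, hQi⟩ := hT.exists_leadVar_eq_of_mem_wCharSet hvar hQ
    have hpar := isParameter_of_mem_vars (hT.wCharSet_member hvar hP hPi hQ hQi).2 hv
    obtain ⟨P', hP', i', hPi', hRi'⟩ := hT.exists_leadVar_eq_of_mem_wCharSet hvar hR
    exact hpar P' hP' (by rw [hPi', ← hRi', hRv])

/-- For ≤, the initials of the W-characteristic set are nonzero parameter polynomials, hence regular
modulo sat(T). For ≥, its members have the same leading degrees as those of T and can replace them
in pseudo-division, one variable at a time. -/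
theorem sat_wCharSet (hT : IsRegularSet T) (hvar : VariableOrderingCondition T) :
    sat (wCharSet (sat T)) = sat T := by
  apply le_antisymm
  · rintro F ⟨k, hk⟩
    have hle : Ideal.span (wCharSet (sat T) : Set (MvPolynomial (Fin n) K)) ≤ sat T :=
      Ideal.span_le.mpr fun Q hQ => groebnerBasis_subset (mem_wCharSet.mp hQ).1
    have hmem : (∏ Q ∈ wCharSet (sat T), initial Q) ^ k ∈ parameterRing T := by
      refine Subalgebra.pow_mem _ (Subalgebra.prod_mem _ fun Q hQ => ?_) k
      obtain ⟨P, hP, i, hPi, hQi⟩ := hT.exists_leadVar_eq_of_mem_wCharSet hvar hQ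
      exact (hT.wCharSet_member hvar hP hPi hQ hQi).2
    have hne : (∏ Q ∈ wCharSet (sat T), initial Q) ^ k ≠ 0 := by
      refine pow_ne_zero k (Finset.prod_ne_zero_iff.mpr fun Q hQ => ?_)
      obtain ⟨P, hP, i, hPi, hQi⟩ := hT.exists_leadVar_eq_of_mem_wCharSet hvar hQ
      rw [initial_eq_leadCoeffIn hQi]
      exact leadCoeffIn_ne_zero (ne_zero_of_leadVar_eq hQi)
    have hreg := hT.regularMod_of_mem_parameterRing hmem hne le_rfl
    rw [chain_top] at hreg
    exact hreg F (by rw [mul_comm]; exact hle hk)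
  · suffices h : ∀ m ≤ n, sat (chain T m) ≤ sat (wCharSet (sat T)) by
      simpa only [chain_top] using h n le_rfl
    intro m
    induction m with
    | zero =>
      intro _
      rw [hT.isTriangularSet.chain_zero, sat_empty]
      exact bot_le
    | succ m ih =>
      intro hm F hF
      by_cases hpar : IsParameter T ⟨m, hm⟩
      · have h := IsTriangularSet.chain_succ_of_isParameter hpar
        simp only at h
        rw [h] at hF
        exact ih (by omega) hF
      · unfold IsParameter at hpar
        push Not at hpar
        obtain ⟨P, hP, hi⟩ := hpar
        obtain ⟨Q, hQ, hQi⟩ := hT.exists_mem_wCharSet hvar hP hi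
        obtain ⟨hdeg, -⟩ := hT.wCharSet_member hvar hP hi hQ hQi
        have hQv := leadVar_eq_coe_iff.mp hQi
        have hQm : Q ∈ sat (chain T (m + 1)) :=
          hT.mem_sat_chain_of_vars_lt hm (fun v hv => Nat.lt_succ_iff.mpr (hQv.2 v hv))
            (groebnerBasis_subset (mem_wCharSet.mp hQ).1)
        obtain ⟨l, b, r, h1, h2⟩ := exists_pseudoDivision hQv.1 F
        have hr : r ∈ sat (chain T (m + 1)) := by
          rw [show r = leadCoeffIn ⟨m, hm⟩ Q ^ l * F - b * Q by rw [h1]; ring]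
          exact Ideal.sub_mem _ (Ideal.mul_mem_left _ _ hF) (Ideal.mul_mem_left _ _ hQm)
        -- The remainder has degree below deg Q = deg P in x_m, so it descends by one variable, to
        -- where the induction hypothesis applies.
        have hr' : r ∈ sat (chain T m) := by
          refine hT.mem_sat_chain_of_degreeOf_lt (Nat.le_succ m) hm ?_ hr
          intro R hR j hj hmj hjm
          obtain rfl : j = ⟨m, hm⟩ := Fin.ext (by simp only; omega)
          rwa [hT.isTriangularSet.leadVar_injOn hR hP (hj.trans hi.symm), ← hdeg]
        rw [← initial_eq_leadCoeffIn hQi] at h1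
        refine (regularMod_sat_initial hQ).pow l F (h1 ▸ Ideal.add_mem _ ?_ (ih (by omega) hr'))
        exact Ideal.mul_mem_left _ _ (span_le_sat _ (Ideal.subset_span hQ))

end IsRegularSet

end TriangularDecomposition

theorem mainTheorem6 {K : Type*} [Field K] [CharZero K] {n : ℕ}
    (F : Set (MvPolynomial (Fin n) K)) {e : ℕ}
    (T : Fin e → Finset (MvPolynomial (Fin n) K))
    (hT : TriangularDecomposition.IsRegularTriangularDecomposition F T)
    (hvar : ∀ i, TriangularDecomposition.VariableOrderingCondition (T i)) :
    TriangularDecomposition.IsStrongNormalCharDecomposition F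
      (fun i => (TriangularDecomposition.groebnerBasis (TriangularDecomposition.sat (T i)),
        TriangularDecomposition.wCharSet (TriangularDecomposition.sat (T i)))) := by
  have hpair : ∀ i, TriangularDecomposition.IsCharPair
      (TriangularDecomposition.groebnerBasis (TriangularDecomposition.sat (T i)))
      (TriangularDecomposition.wCharSet (TriangularDecomposition.sat (T i))) := by
    intro i
    constructor <;> rw [TriangularDecomposition.span_groebnerBasis]
    exact TriangularDecomposition.groebnerBasis_isReduced _
  have hsat := fun i => (hT.regular i).sat_wCharSet (hvar i)
  -- Normality always holds in its proper form; the trivial pair does not arise, since sat(T_i)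
  -- contains no nonzero constant. Both radical identities reduce to the hypothesis because sat(C_i)
  -- = sat(T_i) = ⟨G_i⟩.
  refine ⟨fun i => ⟨hpair i, ?_⟩,
    fun i => ⟨hpair i, Or.inl ((hT.regular i).isNormalSet_wCharSet (hvar i))⟩, ?_, ?_⟩
  · rw [TriangularDecomposition.span_groebnerBasis]
    exact hsat i
  · simp only [hsat]
    exact hT.radical_eq
  · simp only [TriangularDecomposition.span_groebnerBasis]
    exact hT.radical_eq
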